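/- Let $N$ be the thrice-punctured projective plane. Its fundamental group is the free group $F_3=\langle\alpha_1,\alpha_2,\alpha_3\rangle$, where $\alpha_1,\alpha_2,\alpha_3$ are one-sided simple loops meeting only at the base point and $\alpha_1\alpha_2,\alpha_2\alpha_3,\alpha_3\alpha_1$ are peripheral; homotopy classes of unoriented closed curves are the conjugacy classes of $F_3$ up to inversion. Let $\Omega$ be the (dual) curve complex of $N$: - its 3-cells are the homotopy classes $\alpha$ of one-sided simple closed curves on $N$; - its vertices (0-cells) are the sets $\{\alpha,\beta,\gamma,\delta\}$ of four such classes that pairwise geometrically intersect once; - its edges (1-cells) are the sets $\{\alpha,\beta,\gamma\}$ of three such classes that pairwise geometrically intersect once. Each edge lies in exactly two vertices $\{\alpha,\beta,\gamma,\delta\}$ and $\{\alpha,\beta,\gamma,\delta'\}$ and joins them (a flip). Explicitly (Scharlemann), the vertices are the sets of classes $\{[A],[B],[C],[(ABC)^{-1}]\}$, where $(A,B,C)$ runs over the triples in $F_3$ obtained from $(\alpha_1,\alpha_2,\alpha_3)$ by finitely many moves of the forms $(A,B,C)\mapsto(B,C,A)$, $(A,B,C)\mapsto(A,(BCA)^{-1},B)$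 (which do not change the vertex) and $(A,B,C)\mapsto(A,C,B)$ (which flips $[(ABC)^{-1}]$ to $[(ACB)^{-1}]$); the 3-cells are the elements of the vertices, and the edges are the three-element subsets of the vertices. A Markoff map is a function $\phi$ from the set of 3-cells to $\mathbb{C}$ such that, writing $a=\phi(\alpha)$, $b=\phi(\beta)$, $c=\phi(\gamma)$, $d=\phi(\delta)$, $d'=\phi(\delta')$, $$(a+b+c+d)^2=abcd\quad\text{for every vertex }\{\alpha,\beta,\gamma,\delta\},$$ $$(a+b+c+d)+(a+b+c+d')=abc\quad\text{for any two distinct vertices }\{\alpha,\beta,\gamma,\delta\},\ \{\alpha,\beta,\gamma,\delta'\}\text{ joined by an edge}.$$ Given a Markoff map $\phi$, orient each edge $\{\alpha,\beta,\gamma\}$ from $\{\alpha,\beta,\gamma,\delta'\}$ to $\{\alpha,\beta,\gamma,\delta\}$ in such a way that $|d'|\ge|d|$; if $|d'|=|d|$, either of the two directions may be chosen. A sink is a vertex all of whose four edges point towards it. For $k\ge 0$ let $\Omega^3_\phi(k)$ be the set of 3-cells $\alpha$ with $|\phi(\alpha)|\le k$. **Theorem.** For every Markoff map $\phi$, the set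 $\Omega^3_\phi(4)$ is non-empty. Further, if $\Omega^3_\phi(2)=\varnothing$, then for every such choice of edge orientation there is a unique sink. -/

import Mathlib

/-!
The curve complex of one-sided simple closed curves on the thrice-punctured projective plane `N`,
Markoff maps on it, and the edge orientations that a Markoff map induces.

The fundamental group of `N` is free on `α₁, α₂, α₃`, where `α₁, α₂, α₃` are one-sided simple loops
that meet only at the base point, and where `α₁α₂, α₂α₃, α₃α₁` are peripheral.  Homotopy classes of
unoriented closed curves on `N` are conjugacy classes of this group up to inversion.
-/

namespace CurveComplex

/-- The fundamental group of the thrice-punctured projective plane. -/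
abbrev Pi1 : Type := FreeGroup (Fin 3)

/-- Two loops are freely homotopic as unoriented closed curves iff they are conjugate
up to inversion. -/
def curveSetoid : Setoid Pi1 where
  r g h := IsConj g h ∨ IsConj g h⁻¹
  iseqv :=
    { refl := fun g => Or.inl (IsConj.refl g)
      symm := by
        rintro g h (hc | hc)
        · exact Or.inl hc.symm
        · obtain ⟨c, hc⟩ := isConj_iff.mp hc
          refine Or.inr (isConj_iff.mpr ⟨c⁻¹, ?_⟩)
          rw [← inv_inv h, ← hc]
          group
      trans := by
        have inv_conj : ∀ {g h : Pi1}, IsConj g h → IsConj g⁻¹ h⁻¹ := by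
          intro g h hc
          obtain ⟨c, hc⟩ := isConj_iff.mp hc
          refine isConj_iff.mpr ⟨c, ?_⟩
          rw [← hc]
          group
        rintro g h k (h1 | h1) (h2 | h2)
        · exact Or.inl (h1.trans h2)
        · exact Or.inr (h1.trans h2)
        · exact Or.inr (h1.trans (inv_conj h2))
        · have h3 := inv_conj h2
          rw [inv_inv] at h3
          exact Or.inl (h1.trans h3) }

/-- Homotopy classes of unoriented closed curves on the thrice-punctured projective plane. -/
def Curve : Type := Quotient curveSetoid

/-- The curve represented by a loop. -/
def curve (g : Pi1) : Curve := Quotient.mk curveSetoid g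

/-- Ordered triples `(A, B, C)` of free generators of the fundamental group that are represented by
one-sided simple loops meeting only at the base point, such that `AB, BC, CA` are peripheral.

Given such a triple, there are exactly two one-sided simple closed curves which intersect each of
`A, B, C` exactly once, namely `D = (ABC)⁻¹` and `D' = (ACB)⁻¹`.  All these triples arise (up to
conjugation) from the standard one by
* `rotate`: a cyclic relabelling, which does not change `{A, B, C, D}`;
* `exchange`: putting the conjugate `(BCA)⁻¹` of `D` in the place of `C`, so that the quadruple
  `A, B, C, D` becomes `A, D, B, C`;
* `flip`: the triple `(A, C, B)`, which flips the fourth curve `D` to `D'`. -/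
inductive IsOneSidedTriple : Pi1 → Pi1 → Pi1 → Prop
  | base : IsOneSidedTriple (FreeGroup.of 0) (FreeGroup.of 1) (FreeGroup.of 2)
  | rotate {A B C : Pi1} : IsOneSidedTriple A B C → IsOneSidedTriple B C A
  | exchange {A B C : Pi1} : IsOneSidedTriple A B C → IsOneSidedTriple A (B * C * A)⁻¹ B
  | flip {A B C : Pi1} : IsOneSidedTriple A B C → IsOneSidedTriple A C B

/-- The four curves `A, B, C, (ABC)⁻¹`. -/
def quadruple (A B C : Pi1) : Set Curve :=
  {curve A, curve B, curve C, curve (A * B * C)⁻¹}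

/-- The 3-cells: homotopy classes of one-sided simple closed curves. -/
def ThreeCell : Type :=
  {x : Curve // ∃ A B C, IsOneSidedTriple A B C ∧ x ∈ quadruple A B C}

/-- A set of 3-cells is a 0-cell if it consists of four one-sided simple closed curves that pairwise
intersect once. -/
def IsZeroCell (v : Set ThreeCell) : Prop :=
  ∃ A B C, IsOneSidedTriple A B C ∧ (Subtype.val '' v : Set Curve) = quadruple A B C

/-- The 0-cells (vertices). -/
def ZeroCell : Type := {v : Set ThreeCell // IsZeroCell v}

/-- The 1-cells (edges): the three-element faces of the 0-cells. -/
def IsOneCell (e : Set ThreeCell) : Prop :=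
  e.ncard = 3 ∧ ∃ v, IsZeroCell v ∧ e ⊆ v

/-- The 1-skeleton: two distinct 0-cells are the end points of the edge `e = {α, β, γ}` iff both of
them contain `α, β, γ`. -/
def oneSkeleton : SimpleGraph ZeroCell where
  Adj v w := v ≠ w ∧ IsOneCell (v.1 ∩ w.1)
  symm := ⟨fun v w h => ⟨h.1.symm, by rw [Set.inter_comm]; exact h.2⟩⟩
  loopless := ⟨fun _ h => h.1 rfl⟩

/-- Markoff maps: complex functions on the 3-cells satisfying the vertex and the edge relations.
(The relations are written without denominators, as values may vanish.) -/
structure IsMarkoffMap (φ : ThreeCell → ℂ) : Prop where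
  vertex : ∀ α β γ δ : ThreeCell, IsZeroCell {α, β, γ, δ} →
    (φ α + φ β + φ γ + φ δ) ^ 2 = φ α * φ β * φ γ * φ δ
  edge : ∀ α β γ δ δ' : ThreeCell, IsZeroCell {α, β, γ, δ} → IsZeroCell {α, β, γ, δ'} → δ ≠ δ' →
    (φ α + φ β + φ γ + φ δ) + (φ α + φ β + φ γ + φ δ') = φ α * φ β * φ γ

/-- The set of 3-cells at which `|φ| ≤ k`. -/
def smallCells (φ : ThreeCell → ℂ) (k : ℝ) : Set ThreeCell := {x | ‖φ x‖ ≤ k}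

/-- `O` is an edge orientation induced by `φ`: here `O v w` says that `v` and `w` are joined by an
edge which is directed from `v` to `w`.  Each edge `{α, β, γ}` gets exactly one of its two
directions; if it points from `{α, β, γ, δ'}` to `{α, β, γ, δ}`, then `|φ δ'| ≥ |φ δ|`
(the choice is arbitrary in the case of equality). -/
structure IsInducedOrientation (φ : ThreeCell → ℂ) (O : ZeroCell → ZeroCell → Prop) : Prop where
  adj : ∀ v w, O v w → oneSkeleton.Adj v w
  exactly_one : ∀ v w, oneSkeleton.Adj v w → Xor (O v w) (O w v)
  norm_le : ∀ v w, O v w → ∀ δ' ∈ v.1 \ w.1, ∀ δ ∈ w.1 \ v.1, ‖φ δ‖ ≤ ‖φ δ'‖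

/-- A sink: a vertex all of whose edges point towards it. -/
def IsSink (O : ZeroCell → ZeroCell → Prop) (v : ZeroCell) : Prop :=
  ∀ w, oneSkeleton.Adj v w → O w v

end CurveComplex

/-! At a vertex with sum `s = a + b + c + d`, consider the proportions `x = a / s` and so on. They
add up to `1`, and the product of two of them is the reciprocal of the product of the other two
values. Flipping `a` gives `s' / s = (1 - x) / x` and `a' / s' = 1 - x`, so the flip does not
increase `|a|` exactly when `Re x ≥ 1/2`. If all values exceed `2` in modulus, any two proportions
have product below `1/4`, so at most one edge leaves a vertex (`no_fork`). In a connected graph this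
allows at most one sink, since along a path that starts at a sink every edge points back.

A sink exists because there is no infinite descent (`Descent.false`). Along a descent `|s|`
decreases but stays above `4`, which forces the flipped proportions towards `1/2`. Then no colour
can stop being flipped, so at some late time three colours are flipped in succession: three
proportions are near `1/2`, the fourth is near `-1/2`, and `|s|` is near `4`. The fourth colour must
be flipped later, so its proportion has to travel to `1/2` while `|s|` hardly changes, that is, by
near rotations of `s`. A relation between proportion and step excludes near rotations at two nearly
opposite positions (`no_half_turn`).

If some value is at most `2`, the first claim is clear. Otherwise strict descent ends at a vertex
where all proportions have real part at most `1/2`; if all values exceeded `4`, products of pairs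
would be below `1/16`, and the proportions could not add up to `1`.

All this needs exactly one neighbour across each of the four edges of a vertex (`quad_eq_or`). To
see it, the free group is represented by integer matrices with traces `4, 4, 4, 4` at a given
vertex. Traces grow away from that vertex, so three of its curves reappear together only across one
edge. -/

namespace CurveComplex

/-! ### Moves on triples in a group. -/

section Triples

variable {G : Type*}

/-- Cyclic relabelling of a triple. -/
def rot (t : G × G × G) : G × G × G := (t.2.1, t.2.2, t.1)

/-- The flip move on triples. -/
def flp (t : G × G × G) : G × G × G := (t.1, t.2.2, t.2.1)

@[simp] theorem rot_rot_rot (t : G × G × G) : rot (rot (rot t)) = t := rfl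

theorem flp_rot (t : G × G × G) : flp (rot t) = rot (rot (flp t)) := rfl

variable [Group G]

/-- The exchange move on triples. -/
def exch (t : G × G × G) : G × G × G := (t.1, (t.2.1 * t.2.2 * t.1)⁻¹, t.2.1)

/-- Simultaneous conjugation of a triple. -/
def cnj (g : G) (t : G × G × G) : G × G × G :=
  (g * t.1 * g⁻¹, g * t.2.1 * g⁻¹, g * t.2.2 * g⁻¹)

/-- The fourth element determined by a triple. -/
def fourth (t : G × G × G) : G := (t.1 * t.2.1 * t.2.2)⁻¹

/-- The orbit of a triple under the moves which do not change the vertex. -/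
inductive Orb (t : G × G × G) : G × G × G → Prop
  | refl : Orb t t
  | rot {u : G × G × G} : Orb t u → Orb t (rot u)
  | exch {u : G × G × G} : Orb t u → Orb t (exch u)
  | cnj (g : G) {u : G × G × G} : Orb t u → Orb t (cnj g u)

theorem Orb.trans {t u w : G × G × G} (h : Orb t u) (h' : Orb u w) : Orb t w := by
  induction h' with
  | refl => exact h
  | rot _ ih => exact ih.rot
  | exch _ ih => exact ih.exch
  | cnj g _ ih => exact ih.cnj g

theorem flp_cnj (g : G) (t : G × G × G) : flp (cnj g t) = cnj g (flp t) := rfl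

theorem exch_cnj (g : G) (t : G × G × G) : exch (cnj g t) = cnj g (exch t) := by
  simp only [exch, cnj, Prod.mk.injEq, true_and, and_true]
  group

theorem cnj_cnj (g h : G) (t : G × G × G) : cnj g (cnj h t) = cnj (g * h) t := by
  simp only [cnj, Prod.mk.injEq]
  refine ⟨by group, by group, by group⟩

theorem cnj_one (t : G × G × G) : cnj 1 t = t := by simp [cnj]

/-- Up to conjugation `rot` and `exch` permute the four curves as 3-cycles, so they generate a copy
of the tetrahedral rotation group, of order 12. This and the following relations reduce every word
in them to the normal form of `Orb.cases`. -/
theorem exch_exch (t : G × G × G) :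
    exch (exch t) = cnj t.1⁻¹ (rot (rot (exch (rot (rot t))))) := by
  simp only [exch, cnj, rot, Prod.mk.injEq]
  refine ⟨by group, by group, by group⟩

theorem exch_rot_exch (t : G × G × G) :
    exch (rot (exch t)) = cnj t.2.1 (rot (exch (rot t))) := by
  simp only [exch, cnj, rot, Prod.mk.injEq]
  refine ⟨by group, by group, by group⟩

theorem exch_rot_rot_exch (t : G × G × G) : exch (rot (rot (exch t))) = rot t := by
  simp only [exch, rot, Prod.mk.injEq, true_and, and_true]
  group

theorem exch_exch_exch (t : G × G × G) : exch (exch (exch t)) = cnj t.1⁻¹ t := by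
  simp only [exch, cnj, Prod.mk.injEq]
  refine ⟨by group, by group, by group⟩

/-- A triple in the same orbit is, up to rotation and conjugation, the given triple or the exchange
of one of its rotations. -/
theorem Orb.cases {t u : G × G × G} (h : Orb t u) :
    ∃ g, ∃ w, (w = t ∨ w = CurveComplex.exch t ∨ w = CurveComplex.exch (CurveComplex.rot t) ∨
        w = CurveComplex.exch (CurveComplex.rot (CurveComplex.rot t))) ∧
      (u = CurveComplex.cnj g w ∨ u = CurveComplex.cnj g (CurveComplex.rot w) ∨
        u = CurveComplex.cnj g (CurveComplex.rot (CurveComplex.rot w))) := by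
  induction h with
  | refl => exact ⟨1, t, Or.inl rfl, Or.inl (cnj_one t).symm⟩
  | rot _ ih =>
    obtain ⟨g, w, hw, rfl | rfl | rfl⟩ := ih
    · exact ⟨g, w, hw, Or.inr (Or.inl rfl)⟩
    · exact ⟨g, w, hw, Or.inr (Or.inr rfl)⟩
    · exact ⟨g, w, hw, Or.inl rfl⟩
  | cnj g _ ih =>
    obtain ⟨g', w, hw, h⟩ := ih
    refine ⟨g * g', w, hw, ?_⟩
    rcases h with rfl | rfl | rfl <;> simp [cnj_cnj]
  | exch _ ih =>
    obtain ⟨g, w, rfl | rfl | rfl | rfl, rfl | rfl | rfl⟩ := ih <;>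
      simp only [exch_cnj, exch_exch, exch_rot_exch, exch_rot_rot_exch, cnj_cnj,
        rot_rot_rot]
    · exact ⟨g, _, Or.inr (Or.inl rfl), Or.inl rfl⟩
    · exact ⟨g, _, Or.inr (Or.inr (Or.inl rfl)), Or.inl rfl⟩
    · exact ⟨g, _, Or.inr (Or.inr (Or.inr rfl)), Or.inl rfl⟩
    · exact ⟨_, _, Or.inr (Or.inr (Or.inr rfl)), Or.inr (Or.inr rfl)⟩
    · exact ⟨_, _, Or.inr (Or.inr (Or.inl rfl)), Or.inr (Or.inl rfl)⟩
    · exact ⟨g, _, Or.inl rfl, Or.inr (Or.inl rfl)⟩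
    · exact ⟨_, _, Or.inr (Or.inl rfl), Or.inr (Or.inr rfl)⟩
    · exact ⟨_, _, Or.inr (Or.inr (Or.inr rfl)), Or.inr (Or.inl rfl)⟩
    · exact ⟨g, _, Or.inl rfl, Or.inr (Or.inr rfl)⟩
    · exact ⟨_, _, Or.inr (Or.inr (Or.inl rfl)), Or.inr (Or.inr rfl)⟩
    · exact ⟨_, _, Or.inr (Or.inl rfl), Or.inr (Or.inl rfl)⟩
    · exact ⟨g, _, Or.inl rfl, Or.inl rfl⟩

end Triples

/-! ### Trace identities for integer matrices of determinant `-1`. -/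

section Traces

/-- Integer matrices with integer inverses. -/
abbrev GL2Z : Type := (Matrix (Fin 2) (Fin 2) ℤ)ˣ

/-- The trace of an invertible integer matrix. -/
def tr (M : GL2Z) : ℤ := (M : Matrix (Fin 2) (Fin 2) ℤ).trace

/-- The determinant of an invertible integer matrix. -/
def dt (M : GL2Z) : ℤ := (M : Matrix (Fin 2) (Fin 2) ℤ).det

theorem dt_mul (M N : GL2Z) : dt (M * N) = dt M * dt N := by simp [dt]

theorem dt_inv (M : GL2Z) : dt M⁻¹ = dt M := by
  have h : dt M * dt M⁻¹ = 1 := by rw [← dt_mul]; simp [dt]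
  rcases Int.isUnit_iff.mp (IsUnit.of_mul_eq_one _ h) with h' | h' <;> rw [h'] at h ⊢ <;> omega

theorem dt_eq_or (M : GL2Z) : dt M = 1 ∨ dt M = -1 := by
  have h : dt M * dt M⁻¹ = 1 := by rw [← dt_mul]; simp [dt]
  exact Int.isUnit_iff.mp (IsUnit.of_mul_eq_one _ h)

theorem tr_mul_comm (M N : GL2Z) : tr (M * N) = tr (N * M) := by
  exact Matrix.trace_mul_comm _ _

theorem tr_inv (M : GL2Z) : tr M⁻¹ = dt M * tr M := by
  have h : dt M = 1 ∨ dt M = -1 := dt_eq_or M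
  have : ((M⁻¹ : GL2Z) : Matrix (Fin 2) (Fin 2) ℤ) =
      dt M • (M : Matrix (Fin 2) (Fin 2) ℤ).adjugate := by
    rw [Matrix.coe_units_inv, Matrix.inv_def]
    congr 1
    change Ring.inverse (dt M) = dt M
    rcases h with h | h <;> rw [h]
    · simp
    · exact Ring.inverse_unit (-1 : ℤˣ)
  rw [tr, this, Matrix.trace_smul, Matrix.adjugate_fin_two, Matrix.trace_fin_two_of, tr,
    Matrix.trace_fin_two, smul_eq_mul, add_comm]

theorem tr_conj (M N : GL2Z) : tr (N * M * N⁻¹) = tr M := by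
  rw [tr_mul_comm, ← mul_assoc, inv_mul_cancel, one_mul]

theorem dt_conj (M N : GL2Z) : dt (N * M * N⁻¹) = dt M := by
  rw [dt_mul, dt_mul, dt_inv]
  rcases dt_eq_or N with h | h <;> rw [h] <;> ring

/-- The polarised Cayley–Hamilton identity. With determinants `-1` and peripheral traces `2` it
becomes the edge relation. -/
theorem tr_mul_add (M N P : GL2Z) :
    tr (M * N * P) + tr (M * P * N) =
      tr M * tr (N * P) + tr N * tr (P * M) + tr P * tr (M * N) - tr M * tr N * tr P := by
  simp only [tr, Units.val_mul, Matrix.trace_fin_two, Matrix.mul_apply, Fin.sum_univ_two]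
  ring

/-- Triples of matrices whose traces form a positive integer solution of the vertex relation. -/
structure Pos (t : GL2Z × GL2Z × GL2Z) : Prop where
  dt1 : dt t.1 = -1
  dt2 : dt t.2.1 = -1
  dt3 : dt t.2.2 = -1
  tr12 : tr (t.1 * t.2.1) = 2
  tr23 : tr (t.2.1 * t.2.2) = 2
  tr31 : tr (t.2.2 * t.1) = 2
  pos1 : 0 < tr t.1
  pos2 : 0 < tr t.2.1
  pos3 : 0 < tr t.2.2
  pos4 : 0 < tr (fourth t)
  rel : (tr t.1 + tr t.2.1 + tr t.2.2 + tr (fourth t)) ^ 2 =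
    tr t.1 * tr t.2.1 * tr t.2.2 * tr (fourth t)

variable {t : GL2Z × GL2Z × GL2Z}

theorem tr_fourth_rot (t : GL2Z × GL2Z × GL2Z) : tr (fourth (rot t)) = tr (fourth t) := by
  have : fourth (rot t) = t.1⁻¹ * fourth t * t.1⁻¹⁻¹ := by simp only [fourth, rot]; group
  rw [this, tr_conj]

theorem tr_fourth_cnj (g : GL2Z) (t : GL2Z × GL2Z × GL2Z) :
    tr (fourth (cnj g t)) = tr (fourth t) := by
  have : fourth (cnj g t) = g * fourth t * g⁻¹ := by simp only [fourth, cnj]; group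
  rw [this, tr_conj]

theorem fourth_exch {G : Type*} [Group G] (t : G × G × G) : fourth (exch t) = t.2.2 := by
  simp only [fourth, exch]; group

theorem tr_exch_snd (t : GL2Z × GL2Z × GL2Z) : tr (exch t).2.1 = tr (fourth t) :=
  tr_fourth_rot t

theorem Pos.rot (h : Pos t) : Pos (rot t) where
  dt1 := h.dt2
  dt2 := h.dt3
  dt3 := h.dt1
  tr12 := h.tr23
  tr23 := h.tr31
  tr31 := h.tr12
  pos1 := h.pos2
  pos2 := h.pos3
  pos3 := h.pos1
  pos4 := by rw [tr_fourth_rot]; exact h.pos4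
  rel := by
    rw [tr_fourth_rot]
    simp only [CurveComplex.rot]
    linear_combination h.rel

theorem Pos.cnj (g : GL2Z) (h : Pos t) : Pos (cnj g t) := by
  have e : ∀ M N : GL2Z, g * M * g⁻¹ * (g * N * g⁻¹) = g * (M * N) * g⁻¹ := by intros; group
  have e' := tr_fourth_cnj g t
  constructor <;> simp only [CurveComplex.cnj, dt_conj, tr_conj, e] at e' ⊢ <;> try rw [e']
  exacts [h.dt1, h.dt2, h.dt3, h.tr12, h.tr23, h.tr31, h.pos1, h.pos2, h.pos3, h.pos4, h.rel]

theorem Pos.exch (h : Pos t) : Pos (exch t) where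
  dt1 := h.dt1
  dt2 := by simp [CurveComplex.exch, dt_inv, dt_mul, h.dt1, h.dt2, h.dt3]
  dt3 := h.dt2
  tr12 := by
    have : (CurveComplex.exch t).1 * (CurveComplex.exch t).2.1 = (t.2.1 * t.2.2)⁻¹ := by
      simp only [CurveComplex.exch]; group
    rw [this, tr_inv, dt_mul, h.dt2, h.dt3, h.tr23]; norm_num
  tr23 := by
    have : (CurveComplex.exch t).2.1 * (CurveComplex.exch t).2.2 = (t.2.2 * t.1)⁻¹ := by
      simp only [CurveComplex.exch]; group
    rw [this, tr_inv, dt_mul, h.dt3, h.dt1, h.tr31]; norm_num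
  tr31 := by
    have : (CurveComplex.exch t).2.2 * (CurveComplex.exch t).1 = t.2.1 * t.1 := rfl
    rw [this, tr_mul_comm, h.tr12]
  pos1 := h.pos1
  pos2 := by rw [tr_exch_snd]; exact h.pos4
  pos3 := h.pos2
  pos4 := by rw [fourth_exch]; exact h.pos3
  rel := by
    rw [tr_exch_snd, fourth_exch]
    simp only [CurveComplex.exch]
    linear_combination h.rel

theorem Pos.tr_fourth_flp (h : Pos t) :
    tr (fourth (flp t)) + tr (fourth t) =
      tr t.1 * tr t.2.1 * tr t.2.2 - 2 * (tr t.1 + tr t.2.1 + tr t.2.2) := by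
  have e := tr_mul_add t.1 t.2.1 t.2.2
  simp only [fourth, flp, tr_inv, dt_mul, h.dt1, h.dt2, h.dt3]
  rw [h.tr12, h.tr23, h.tr31] at e
  linear_combination -e

/-- Vieta: the vertex relation is quadratic in the fourth trace, and a flip exchanges its roots.
Hence the larger root is at least the sum of the other three traces. -/
theorem Pos.tr_fourth_mul (h : Pos t) :
    tr (fourth (flp t)) * tr (fourth t) = (tr t.1 + tr t.2.1 + tr t.2.2) ^ 2 := by
  linear_combination tr (fourth t) * h.tr_fourth_flp - h.rel

theorem Pos.flp (h : Pos t) : Pos (flp t) where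
  dt1 := h.dt1
  dt2 := h.dt3
  dt3 := h.dt2
  tr12 := by rw [tr_mul_comm]; exact h.tr31
  tr23 := by rw [tr_mul_comm]; exact h.tr23
  tr31 := by rw [tr_mul_comm]; exact h.tr12
  pos1 := h.pos1
  pos2 := h.pos3
  pos3 := h.pos2
  pos4 := by
    have h1 := h.tr_fourth_mul
    have h2 := h.pos1
    have h3 := h.pos2
    have h4 := h.pos3
    exact pos_of_mul_pos_left (by rw [h1]; positivity) h.pos4.le
  rel := by
    have e := h.tr_fourth_flp
    have e' := h.rel
    simp only [CurveComplex.flp] at e ⊢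
    simp only [CurveComplex.fourth] at e e' ⊢
    rw [eq_sub_of_add_eq e]
    linear_combination e'

theorem Pos.orb {u : GL2Z × GL2Z × GL2Z} (h : Pos t) (hu : Orb t u) : Pos u := by
  induction hu with
  | refl => exact h
  | rot _ ih => exact ih.rot
  | exch _ ih => exact ih.exch
  | cnj g _ ih => exact ih.cnj g

/-- A non-increasing flip replaces a value which is at least the sum of the others. -/
theorem Pos.le_of_flp_le (h : Pos t) (h' : tr (fourth (CurveComplex.flp t)) ≤ tr (fourth t)) :
    tr t.1 + tr t.2.1 + tr t.2.2 ≤ tr (fourth t) := by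
  have h1 := h.tr_fourth_mul
  have h2 := h.pos1
  have h3 := h.pos2
  have h4 := h.pos3
  have h5 := h.pos4
  nlinarith

end Traces

/-! ### Growth of traces away from a root vertex. -/

section Growth

variable {G : Type*} [Group G] (ρ : G →* GL2Z)

/-- The image of a triple under a representation. -/
def mapT (t : G × G × G) : GL2Z × GL2Z × GL2Z := (ρ t.1, ρ t.2.1, ρ t.2.2)

theorem mapT_exch (t : G × G × G) : mapT ρ (exch t) = exch (mapT ρ t) := by simp [mapT, exch]

theorem mapT_cnj (g : G) (t : G × G × G) : mapT ρ (cnj g t) = cnj (ρ g) (mapT ρ t) := by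
  simp [mapT, cnj]

theorem fourth_mapT (t : G × G × G) : fourth (mapT ρ t) = ρ (fourth t) := by
  simp only [fourth, mapT, map_inv, map_mul]

theorem Orb.mapT {t u : G × G × G} (h : Orb t u) :
    Orb (CurveComplex.mapT ρ t) (CurveComplex.mapT ρ u) := by
  induction h with
  | refl => exact Orb.refl
  | rot _ ih => exact ih.rot
  | exch _ ih => rw [mapT_exch]; exact ih.exch
  | cnj g _ ih => rw [mapT_cnj]; exact ih.cnj _

/-- The sum of the first three traces of a triple. -/
def sumTr (t : GL2Z × GL2Z × GL2Z) : ℤ := tr t.1 + tr t.2.1 + tr t.2.2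

theorem sumTr_rot (t : GL2Z × GL2Z × GL2Z) : sumTr (rot t) = sumTr t := by
  simp only [sumTr, rot]; ring

theorem sumTr_cnj (g : GL2Z) (t : GL2Z × GL2Z × GL2Z) : sumTr (cnj g t) = sumTr t := by
  simp only [sumTr, cnj, tr_conj]

/-- All four traces are equal to `4`. -/
def AllFour (t : GL2Z × GL2Z × GL2Z) : Prop :=
  tr t.1 = 4 ∧ tr t.2.1 = 4 ∧ tr t.2.2 = 4 ∧ tr (fourth t) = 4

/-- One of the four traces is equal to `36`, and the others are equal to `4`. -/
def OneBig (t : GL2Z × GL2Z × GL2Z) : Prop :=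
  (tr t.1 = 36 ∧ tr t.2.1 = 4 ∧ tr t.2.2 = 4 ∧ tr (fourth t) = 4) ∨
  (tr t.1 = 4 ∧ tr t.2.1 = 36 ∧ tr t.2.2 = 4 ∧ tr (fourth t) = 4) ∨
  (tr t.1 = 4 ∧ tr t.2.1 = 4 ∧ tr t.2.2 = 36 ∧ tr (fourth t) = 4) ∨
  (tr t.1 = 4 ∧ tr t.2.1 = 4 ∧ tr t.2.2 = 4 ∧ tr (fourth t) = 36)

/-- All traces are at least `4`, and at least two of them are greater. -/
def TwoBig (t : GL2Z × GL2Z × GL2Z) : Prop :=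
  4 ≤ tr t.1 ∧ 4 ≤ tr t.2.1 ∧ 4 ≤ tr t.2.2 ∧ 4 ≤ tr (fourth t) ∧
  12 < tr t.1 + tr t.2.1 + tr t.2.2 ∧ 12 < tr t.1 + tr t.2.1 + tr (fourth t) ∧
  12 < tr t.1 + tr t.2.2 + tr (fourth t) ∧ 12 < tr t.2.1 + tr t.2.2 + tr (fourth t)

theorem AllFour.orb {t u : GL2Z × GL2Z × GL2Z} (h : AllFour t) (hu : Orb t u) : AllFour u := by
  induction hu with
  | refl => exact h
  | rot _ ih => simp only [AllFour, tr_fourth_rot] at ih ⊢; simp only [rot]; omega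
  | exch _ ih =>
    simp only [AllFour, fourth_exch, tr_exch_snd] at ih ⊢; simp only [exch]; omega
  | cnj g _ ih =>
    simp only [AllFour, tr_fourth_cnj] at ih ⊢; simp only [cnj, tr_conj]; omega

theorem OneBig.orb {t u : GL2Z × GL2Z × GL2Z} (h : OneBig t) (hu : Orb t u) : OneBig u := by
  induction hu with
  | refl => exact h
  | rot _ ih => simp only [OneBig, tr_fourth_rot] at ih ⊢; simp only [rot]; omega
  | exch _ ih =>
    simp only [OneBig, fourth_exch, tr_exch_snd] at ih ⊢; simp only [exch]; omega
  | cnj g _ ih =>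
    simp only [OneBig, tr_fourth_cnj] at ih ⊢; simp only [cnj, tr_conj]; omega

theorem TwoBig.orb {t u : GL2Z × GL2Z × GL2Z} (h : TwoBig t) (hu : Orb t u) : TwoBig u := by
  induction hu with
  | refl => exact h
  | rot _ ih => simp only [TwoBig, tr_fourth_rot] at ih ⊢; simp only [rot]; omega
  | exch _ ih =>
    simp only [TwoBig, fourth_exch, tr_exch_snd] at ih ⊢; simp only [exch]; omega
  | cnj g _ ih =>
    simp only [TwoBig, tr_fourth_cnj] at ih ⊢; simp only [cnj, tr_conj]; omega

/-- `4 * 4 * 4 - 2 * (4 + 4 + 4) - 4 = 36`. -/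
theorem AllFour.flp {t : GL2Z × GL2Z × GL2Z} (h : AllFour t) (hp : Pos t) : OneBig (flp t) := by
  have := hp.tr_fourth_flp
  obtain ⟨h1, h2, h3, h4⟩ := h
  rw [h1, h2, h3, h4] at this
  exact Or.inr (Or.inr (Or.inr ⟨h1, h3, h2, by omega⟩))

theorem OneBig.flp {t : GL2Z × GL2Z × GL2Z} (h : OneBig t) (hp : Pos t)
    (hlt : tr (fourth t) < tr (fourth (flp t))) : TwoBig (flp t) := by
  have := hp.tr_fourth_flp
  simp only [TwoBig, CurveComplex.flp] at *
  rcases h with ⟨h1, h2, h3, h4⟩ | ⟨h1, h2, h3, h4⟩ | ⟨h1, h2, h3, h4⟩ | ⟨h1, h2, h3, h4⟩ <;>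
    rw [h1, h2, h3, h4] at this <;> omega

theorem TwoBig.flp {t : GL2Z × GL2Z × GL2Z} (h : TwoBig t)
    (hlt : tr (fourth t) < tr (fourth (flp t))) : TwoBig (flp t) := by
  simp only [TwoBig, CurveComplex.flp] at *
  omega

/-- The triples which are obtained from `t₀` by moves whose flips increase the trace. -/
inductive Ascent (t₀ : G × G × G) : G × G × G → Prop
  | base : Ascent t₀ t₀
  | rot {t : G × G × G} : Ascent t₀ t → Ascent t₀ (rot t)
  | exch {t : G × G × G} : Ascent t₀ t → Ascent t₀ (exch t)
  | cnj (g : G) {t : G × G × G} : Ascent t₀ t → Ascent t₀ (cnj g t)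
  | up {t : G × G × G} : Ascent t₀ t → tr (ρ (fourth t)) < tr (ρ (fourth (flp t))) →
      Ascent t₀ (flp t)

variable {ρ} {t₀ t : G × G × G}

theorem Ascent.pos (h₀ : Pos (mapT ρ t₀)) (h : Ascent ρ t₀ t) : Pos (mapT ρ t) := by
  induction h with
  | base => exact h₀
  | rot _ ih => exact ih.rot
  | exch _ ih => rw [mapT_exch]; exact ih.exch
  | cnj g _ ih => rw [mapT_cnj]; exact ih.cnj _
  | up _ _ ih => exact ih.flp

/-- Only one of four positive numbers can be at least the sum of the other three. After an
increasing flip this is the new trace, so the only flip that does not increase is the one that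
undoes the last step. -/
theorem Ascent.flp_of_orb (h₀ : Pos (mapT ρ t₀)) (h4 : AllFour (mapT ρ t₀))
    (h : Ascent ρ t₀ t) : ∀ u, Orb t u → tr (ρ (fourth (flp u))) ≤ tr (ρ (fourth u)) →
      Ascent ρ t₀ (flp u) := by
  induction h with
  | base =>
    intro u hu hle
    have h1 := h₀.orb (hu.mapT ρ)
    have h2 := h1.tr_fourth_flp
    obtain ⟨a1, a2, a3, a4⟩ := h4.orb (hu.mapT ρ)
    rw [a1, a2, a3, a4] at h2
    rw [← fourth_mapT, ← fourth_mapT, a4] at hle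
    change tr (fourth (flp (mapT ρ u))) ≤ 4 at hle
    omega
  | rot _ ih => exact fun u hu => ih u (Orb.refl.rot.trans hu)
  | exch _ ih => exact fun u hu => ih u (Orb.refl.exch.trans hu)
  | cnj g _ ih => exact fun u hu => ih u ((Orb.refl.cnj g).trans hu)
  | @up t ht hlt ih =>
    intro u hu hle
    have hp := ht.pos h₀
    have hpu := (hp.flp (t := mapT ρ t)).orb (hu.mapT ρ)
    obtain ⟨g, w, hw, hu'⟩ := hu.cases
    have hs : sumTr (mapT ρ w) ≤ tr (fourth (mapT ρ w)) := by
      have : sumTr (mapT ρ u) ≤ tr (fourth (mapT ρ u)) := by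
        rw [← fourth_mapT, ← fourth_mapT] at hle
        exact hpu.le_of_flp_le hle
      rcases hu' with rfl | rfl | rfl
      · rwa [mapT_cnj, sumTr_cnj, tr_fourth_cnj] at this
      · rw [mapT_cnj, sumTr_cnj, tr_fourth_cnj] at this
        rwa [← sumTr_rot, ← tr_fourth_rot]
      · rw [mapT_cnj, sumTr_cnj, tr_fourth_cnj] at this
        rwa [← sumTr_rot, ← sumTr_rot, ← tr_fourth_rot, ← tr_fourth_rot (CurveComplex.rot _)]
    -- The old and the new trace have the square of this sum as product, so the larger one exceeds
    -- it.
    have hlt' : sumTr (mapT ρ t) < tr (fourth (flp (mapT ρ t))) := by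
      by_contra hcon
      rw [← fourth_mapT, ← fourth_mapT] at hlt
      have := (hp.flp (t := mapT ρ t)).tr_fourth_mul
      have h1 := hp.pos1
      have h2 := hp.pos2
      have h3 := hp.pos3
      have h4 := hp.pos4
      have h5 := hp.tr_fourth_mul
      simp only [sumTr] at hcon
      change tr (fourth (mapT ρ t)) < tr (fourth (flp (mapT ρ t))) at hlt
      nlinarith
    have hpos := hp.flp
    have p1 := hpos.pos1
    have p2 := hpos.pos2
    have p3 := hpos.pos3
    have p4 := hpos.pos4
    rcases hw with rfl | rfl | rfl | rfl
    · rcases hu' with rfl | rfl | rfl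
      · exact ht.cnj g
      · exact ht.rot.rot.cnj g
      · exact ht.rot.cnj g
    -- Here the trace about to be flipped is an old one, yet it would have to dominate a sum that
    -- contains the new one.
    all_goals
      exfalso
      rw [mapT_exch, fourth_exch, sumTr, tr_exch_snd] at hs
    · change tr (ρ t.1) + tr (fourth (flp (mapT ρ t))) + tr (ρ t.2.2) ≤ tr (ρ t.2.1) at hs
      change tr (ρ t.1) + tr (ρ t.2.1) + tr (ρ t.2.2) < _ at hlt'
      change 0 < tr (ρ t.1) at p1
      change 0 < tr (ρ t.2.2) at p2
      omega
    · change tr (ρ t.2.2) + tr (fourth (CurveComplex.rot (CurveComplex.flp (mapT ρ t)))) + tr (ρ t.2.1) ≤ tr (ρ t.1) at hs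
      rw [tr_fourth_rot] at hs
      change tr (ρ t.1) + tr (ρ t.2.1) + tr (ρ t.2.2) < _ at hlt'
      change 0 < tr (ρ t.2.1) at p3
      change 0 < tr (ρ t.2.2) at p2
      omega
    · change tr (ρ t.2.1) + tr (fourth (CurveComplex.rot (CurveComplex.rot (CurveComplex.flp (mapT ρ t))))) + tr (ρ t.1) ≤
        tr (ρ t.2.2) at hs
      rw [tr_fourth_rot, tr_fourth_rot] at hs
      change tr (ρ t.1) + tr (ρ t.2.1) + tr (ρ t.2.2) < _ at hlt'
      change 0 < tr (ρ t.1) at p1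
      change 0 < tr (ρ t.2.1) at p3
      omega

theorem Ascent.flp (h₀ : Pos (mapT ρ t₀)) (h4 : AllFour (mapT ρ t₀))
    (h : Ascent ρ t₀ t) : Ascent ρ t₀ (flp t) := by
  rcases lt_or_ge (tr (ρ (fourth t))) (tr (ρ (fourth (CurveComplex.flp t)))) with h' | h'
  · exact h.up h'
  · exact h.flp_of_orb h₀ h4 t Orb.refl h'

/-- Away from the root and its neighbours, at least two of the four traces exceed those at the
root. -/
theorem Ascent.growth (h₀ : Pos (mapT ρ t₀)) (h4 : AllFour (mapT ρ t₀)) (h : Ascent ρ t₀ t) :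
    Orb t₀ t ∨ (∃ t₁, Orb t₀ t₁ ∧ Orb (CurveComplex.flp t₁) t) ∨ TwoBig (mapT ρ t) := by
  induction h with
  | base => exact Or.inl Orb.refl
  | rot _ ih =>
    rcases ih with h | ⟨t₁, h1, h2⟩ | h
    · exact Or.inl h.rot
    · exact Or.inr (Or.inl ⟨t₁, h1, h2.rot⟩)
    · exact Or.inr (Or.inr (h.orb Orb.refl.rot))
  | exch _ ih =>
    rcases ih with h | ⟨t₁, h1, h2⟩ | h
    · exact Or.inl h.exch
    · exact Or.inr (Or.inl ⟨t₁, h1, h2.exch⟩)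
    · rw [mapT_exch]; exact Or.inr (Or.inr (h.orb Orb.refl.exch))
  | cnj g _ ih =>
    rcases ih with h | ⟨t₁, h1, h2⟩ | h
    · exact Or.inl (h.cnj g)
    · exact Or.inr (Or.inl ⟨t₁, h1, h2.cnj g⟩)
    · rw [mapT_cnj]; exact Or.inr (Or.inr (h.orb (Orb.refl.cnj _)))
  | @up t ht hlt ih =>
    rw [← fourth_mapT, ← fourth_mapT] at hlt
    rcases ih with h | ⟨t₁, h1, h2⟩ | h
    · exact Or.inr (Or.inl ⟨t, h, Orb.refl⟩)
    · refine Or.inr (Or.inr (OneBig.flp (t := mapT ρ t) ?_ (ht.pos h₀) hlt))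
      exact OneBig.orb (((h4.orb (h1.mapT ρ)).flp (h₀.orb (h1.mapT ρ)))) (h2.mapT ρ)
    · exact Or.inr (Or.inr (h.flp hlt))

end Growth

/-! ### Every triple can serve as the root. -/

section Fundamental

/-- The three elements of a triple may be sent to arbitrary elements of a group. -/
theorem IsOneSidedTriple.exists_hom {H : Type*} [Group H] {A B C : Pi1}
    (h : IsOneSidedTriple A B C) (x y z : H) : ∃ θ : Pi1 →* H, θ A = x ∧ θ B = y ∧ θ C = z := by
  induction h generalizing x y z with
  | base => exact ⟨FreeGroup.lift ![x, y, z], by simp, by simp, by simp⟩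
  | rotate _ ih =>
    obtain ⟨θ, h1, h2, h3⟩ := ih z x y
    exact ⟨θ, h2, h3, h1⟩
  | exchange _ ih =>
    obtain ⟨θ, h1, h2, h3⟩ := ih x z (z⁻¹ * y⁻¹ * x⁻¹)
    refine ⟨θ, h1, ?_, h2⟩
    rw [map_inv, map_mul, map_mul, h1, h2, h3]
    group
  | flip _ ih =>
    obtain ⟨θ, h1, h2, h3⟩ := ih x z y
    exact ⟨θ, h1, h3, h2⟩

/-- A property of triples which is invariant under the moves and under conjugation passes from one
triple to all others. -/
theorem IsOneSidedTriple.transfer {S : Pi1 × Pi1 × Pi1 → Prop}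
    (hrot : ∀ t, S t → S (rot t)) (hexch : ∀ t, S t → S (exch t))
    (hcnj : ∀ g t, S t → S (cnj g t)) (hflp : ∀ t, S t → S (flp t))
    {A B C A' B' C' : Pi1} (h : IsOneSidedTriple A B C) (h' : IsOneSidedTriple A' B' C')
    (hS : S (A, B, C)) : S (A', B', C') := by
  have hb : S (FreeGroup.of 0, FreeGroup.of 1, FreeGroup.of 2) := by
    induction h with
    | base => exact hS
    | rotate _ ih => exact ih (hrot _ (hrot _ hS))
    | @exchange A B C _ ih =>
      -- `exch` has order three up to conjugation, so two more applications and a conjugation undo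
      -- it.
      have := hcnj A _ (hexch _ (hexch _ hS))
      change S (cnj A (exch (exch (exch (A, B, C))))) at this
      rw [exch_exch_exch, cnj_cnj, mul_inv_cancel, cnj_one] at this
      exact ih this
    | flip _ ih => exact ih (hflp _ hS)
  clear hS
  induction h' with
  | base => exact hb
  | rotate _ ih => exact hrot _ ih
  | exchange _ ih => exact hexch _ ih
  | flip _ ih => exact hflp _ ih

/-- The matrix representing the first element of a triple. -/
def genMat1 : GL2Z := ⟨!![0, 1; 1, 4], !![-4, 1; 1, 0], by decide, by decide⟩

/-- The matrix representing the second element of a triple. -/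
def genMat2 : GL2Z := ⟨!![4, 1; 1, 0], !![0, 1; 1, -4], by decide, by decide⟩

/-- The matrix representing the third element of a triple. -/
def genMat3 : GL2Z := ⟨!![2, -1; -5, 2], !![-2, -1; -5, -2], by decide, by decide⟩

/-- The traces `4, 4, 4, 4` solve the vertex relation, as `16 ^ 2 = 4 ^ 4`. Determinant `-1`
reflects one-sidedness, and trace `2` of the products reflects the punctures. -/
theorem exists_rep {A B C : Pi1} (h : IsOneSidedTriple A B C) :
    ∃ ρ : Pi1 →* GL2Z, Pos (mapT ρ (A, B, C)) ∧ AllFour (mapT ρ (A, B, C)) := by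
  obtain ⟨ρ, h1, h2, h3⟩ := h.exists_hom genMat1 genMat2 genMat3
  refine ⟨ρ, ?_, ?_⟩
  · simp only [mapT, h1, h2, h3]
    constructor <;> decide
  · simp only [mapT, h1, h2, h3, AllFour]
    decide

end Fundamental

/-! ### Colours of curves, and the vertices that share three curves. -/

section Curves

theorem curve_conj (g a : Pi1) : curve (g * a * g⁻¹) = curve a :=
  Quotient.sound (Or.inl (IsConj.symm (isConj_iff.mpr ⟨g, rfl⟩)))

theorem curve_inv (a : Pi1) : curve a⁻¹ = curve a :=
  Quotient.sound (Or.inr (IsConj.refl _))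

/-- The absolute value of the trace of a curve. -/
def absTr (ρ : Pi1 →* GL2Z) : Curve → ℤ :=
  Quotient.lift (fun g => |tr (ρ g)|) (by
    have key : ∀ g h : Pi1, IsConj g h → |tr (ρ g)| = |tr (ρ h)| := by
      intro g h hc
      obtain ⟨c, rfl⟩ := isConj_iff.mp hc
      rw [map_mul, map_mul, map_inv, tr_conj]
    rintro g h (hc | hc)
    · exact key g h hc
    · rw [key g _ hc, map_inv, tr_inv, abs_mul]
      rcases dt_eq_or (ρ h) with h' | h' <;> rw [h'] <;> simp)

theorem absTr_curve (ρ : Pi1 →* GL2Z) (g : Pi1) : absTr ρ (curve g) = |tr (ρ g)| := rfl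

/-- The colours of the 3-cells: the four classes in the mod `2` homology of the surface, modulo the
common sum. -/
abbrev Color : Type := ZMod 2 × ZMod 2

/-- The homomorphism which defines the colours. -/
def colorHom : Pi1 →* Multiplicative Color :=
  FreeGroup.lift ![Multiplicative.ofAdd (1, 0), Multiplicative.ofAdd (0, 1),
    Multiplicative.ofAdd (1, 1)]

theorem colorHom_inv (g : Pi1) : colorHom g⁻¹ = colorHom g := by
  rw [map_inv]
  generalize colorHom g = x
  revert x
  change ∀ x : Color, -x = x
  decide

/-- The colour of a curve. -/
def color : Curve → Color :=
  Quotient.lift (fun g => Multiplicative.toAdd (colorHom g)) (by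
    have key : ∀ g h : Pi1, IsConj g h → colorHom g = colorHom h := by
      intro g h hc
      obtain ⟨c, rfl⟩ := isConj_iff.mp hc
      rw [map_mul, map_mul, map_inv, mul_comm, inv_mul_cancel_left]
    rintro g h (hc | hc)
    · exact congrArg Multiplicative.toAdd (key g h hc)
    · exact congrArg Multiplicative.toAdd ((key g _ hc).trans (colorHom_inv h)))

theorem color_mul (g h : Pi1) : color (curve (g * h)) = color (curve g) + color (curve h) :=
  congrArg Multiplicative.toAdd (map_mul colorHom g h)

theorem color_fourth (t : Pi1 × Pi1 × Pi1) : color (curve (fourth t)) =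
    color (curve t.1) + color (curve t.2.1) + color (curve t.2.2) := by
  rw [fourth, curve_inv, color_mul, color_mul]

/-- The four curves of a triple. -/
def quad (t : Pi1 × Pi1 × Pi1) : Set Curve := quadruple t.1 t.2.1 t.2.2

theorem mem_quad {t : Pi1 × Pi1 × Pi1} {x : Curve} : x ∈ quad t ↔
    x = curve t.1 ∨ x = curve t.2.1 ∨ x = curve t.2.2 ∨ x = curve (fourth t) := Iff.rfl

theorem curve_fourth_rot (t : Pi1 × Pi1 × Pi1) :
    curve (fourth (rot t)) = curve (fourth t) := by
  have : fourth (rot t) = t.1⁻¹ * fourth t * t.1⁻¹⁻¹ := by simp only [fourth, rot]; group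
  rw [this, curve_conj]

theorem quad_rot (t : Pi1 × Pi1 × Pi1) : quad (rot t) = quad t := by
  ext x
  rw [mem_quad, mem_quad, curve_fourth_rot]
  simp only [rot]
  tauto

theorem quad_exch (t : Pi1 × Pi1 × Pi1) : quad (exch t) = quad t := by
  ext x
  have : curve (exch t).2.1 = curve (fourth t) := curve_fourth_rot t
  rw [mem_quad, mem_quad, fourth_exch, this]
  simp only [exch]
  tauto

theorem quad_cnj (g : Pi1) (t : Pi1 × Pi1 × Pi1) : quad (cnj g t) = quad t := by
  ext x
  have : fourth (cnj g t) = g * fourth t * g⁻¹ := by simp only [fourth, cnj]; group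
  rw [mem_quad, mem_quad, this]
  simp only [cnj, curve_conj]

theorem quad_orb {t u : Pi1 × Pi1 × Pi1} (h : Orb t u) : quad u = quad t := by
  induction h with
  | refl => rfl
  | rot _ ih => rw [quad_rot, ih]
  | exch _ ih => rw [quad_exch, ih]
  | cnj g _ ih => rw [quad_cnj, ih]

/-- The triples of the curve complex. -/
def IsT (t : Pi1 × Pi1 × Pi1) : Prop := IsOneSidedTriple t.1 t.2.1 t.2.2

/-- For distinct `a`, `b`, `c` in the four-element group, `a + b + c` is the remaining element, so
the moves preserve distinctness. It follows that a vertex has exactly one curve of each colour. -/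
theorem color_ne {A B C : Pi1} (h : IsOneSidedTriple A B C) :
    color (curve A) ≠ color (curve B) ∧ color (curve B) ≠ color (curve C) ∧
      color (curve C) ≠ color (curve A) := by
  induction h with
  | base =>
    have h0 : color (curve (FreeGroup.of 0)) = (1, 0) :=
      congrArg Multiplicative.toAdd (FreeGroup.lift_apply_of)
    have h1 : color (curve (FreeGroup.of 1)) = (0, 1) :=
      congrArg Multiplicative.toAdd (FreeGroup.lift_apply_of)
    have h2 : color (curve (FreeGroup.of 2)) = (1, 1) :=
      congrArg Multiplicative.toAdd (FreeGroup.lift_apply_of)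
    rw [h0, h1, h2]
    decide
  | rotate _ ih => exact ⟨ih.2.1, ih.2.2, ih.1⟩
  | exchange _ ih =>
    rw [curve_inv, color_mul, color_mul]
    revert ih
    generalize color (curve _) = a
    generalize color (curve _) = b
    generalize color (curve _) = c
    revert a b c
    decide
  | flip _ ih => exact ⟨ih.2.2.symm, ih.2.1.symm, ih.1.symm⟩

theorem color_inj {t : Pi1 × Pi1 × Pi1} (h : IsT t) {x y : Curve} (hx : x ∈ quad t)
    (hy : y ∈ quad t) (hxy : color x = color y) : x = y := by
  have hne := color_ne h
  have h4 := color_fourth t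
  have key : ∀ a b c d : Color, (a ≠ b ∧ b ≠ c ∧ c ≠ a) → d = a + b + c →
      d ≠ a ∧ d ≠ b ∧ d ≠ c := by decide
  obtain ⟨k1, k2, k3⟩ := key _ _ _ _ hne h4
  obtain ⟨n1, n2, n3⟩ := hne
  rw [mem_quad] at hx hy
  rcases hx with rfl | rfl | rfl | rfl <;> rcases hy with rfl | rfl | rfl | rfl <;>
    first
    | rfl
    | exact absurd hxy ‹_›
    | exact absurd hxy.symm ‹_›

theorem color_surj {t : Pi1 × Pi1 × Pi1} (h : IsT t) (k : Color) : ∃ x ∈ quad t, color x = k := by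
  have key : ∀ a b c k : Color, (a ≠ b ∧ b ≠ c ∧ c ≠ a) →
      k = a ∨ k = b ∨ k = c ∨ k = a + b + c := by decide
  have h' := key _ _ _ k (color_ne h)
  rw [← color_fourth] at h'
  rcases h' with rfl | rfl | rfl | rfl
  · exact ⟨_, Or.inl rfl, rfl⟩
  · exact ⟨_, Or.inr (Or.inl rfl), rfl⟩
  · exact ⟨_, Or.inr (Or.inr (Or.inl rfl)), rfl⟩
  · exact ⟨_, Or.inr (Or.inr (Or.inr rfl)), rfl⟩

/-- With `t` as the root, the two curves have traces `36` and `4`. -/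
theorem curve_fourth_flp_ne {t : Pi1 × Pi1 × Pi1} (h : IsT t) :
    curve (fourth (flp t)) ≠ curve (fourth t) := by
  obtain ⟨ρ, hp, h1, h2, h3, h4⟩ := exists_rep h
  intro he
  have e := congrArg (absTr ρ) he
  have h5 := hp.tr_fourth_flp
  rw [h1, h2, h3, h4] at h5
  rw [absTr_curve, absTr_curve, ← fourth_mapT, ← fourth_mapT] at e
  change |tr (fourth (flp (mapT ρ t)))| = |tr (fourth (mapT ρ t))| at e
  change tr (fourth (mapT ρ t)) = 4 at h4
  change tr (fourth (flp (mapT ρ t))) + 4 = _ at h5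
  rw [h4, eq_sub_of_add_eq h5] at e
  norm_num at e

theorem curve_mem_of_bigger {ρ : Pi1 →* GL2Z} {t : Pi1 × Pi1 × Pi1} {x : Curve}
    (hx : x ∈ quad (flp t)) (h36 : tr (ρ (fourth (flp t))) = 36) (hx4 : absTr ρ x = 4) :
    x = curve t.1 ∨ x = curve t.2.1 ∨ x = curve t.2.2 := by
  rcases mem_quad.mp hx with h | h | h | h
  · exact Or.inl h
  · exact Or.inr (Or.inr h)
  · exact Or.inr (Or.inl h)
  · rw [h, absTr_curve, h36] at hx4
    norm_num at hx4

/-- Three curves of a vertex lie in at most two vertices. -/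
theorem quad_eq_or {t₀ t : Pi1 × Pi1 × Pi1} (h₀ : IsT t₀) (h : IsT t) (h1 : curve t₀.1 ∈ quad t)
    (h2 : curve t₀.2.1 ∈ quad t) (h3 : curve t₀.2.2 ∈ quad t) :
    quad t = quad t₀ ∨ quad t = quad (flp t₀) := by
  obtain ⟨ρ, hp, h4⟩ := exists_rep h₀
  have hA : Ascent ρ t₀ t :=
    IsOneSidedTriple.transfer (S := Ascent ρ t₀) (fun _ h => h.rot) (fun _ h => h.exch)
      (fun g _ h => h.cnj g) (fun _ h => h.flp hp h4) h₀ h Ascent.base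
  obtain ⟨n1, n2, n3⟩ := color_ne h₀
  have w1 : absTr ρ (curve t₀.1) = 4 := by
    rw [absTr_curve]; change |tr (mapT ρ t₀).1| = 4; rw [h4.1]; rfl
  have w2 : absTr ρ (curve t₀.2.1) = 4 := by
    rw [absTr_curve]; change |tr (mapT ρ t₀).2.1| = 4; rw [h4.2.1]; rfl
  have w3 : absTr ρ (curve t₀.2.2) = 4 := by
    rw [absTr_curve]; change |tr (mapT ρ t₀).2.2| = 4; rw [h4.2.2.1]; rfl
  rcases hA.growth hp h4 with ho | ⟨t₁, ho, ho'⟩ | hb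
  · exact Or.inl (quad_orb ho)
  · have hq := quad_orb ho'
    have h36 : tr (ρ (fourth (flp t₁))) = 36 := by
      have a1 := hp.orb (ho.mapT ρ)
      have a2 := a1.tr_fourth_flp
      obtain ⟨b1, b2, b3, b4⟩ := h4.orb (ho.mapT ρ)
      rw [b1, b2, b3, b4] at a2
      rw [← fourth_mapT]
      change tr (fourth (flp (mapT ρ t₁))) = 36
      omega
    rw [hq] at h1 h2 h3
    have c1 := curve_mem_of_bigger h1 h36 w1
    have c2 := curve_mem_of_bigger h2 h36 w2
    have c3 := curve_mem_of_bigger h3 h36 w3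
    obtain ⟨g, w, hw, hu⟩ := ho.cases
    have hmem : ∀ x : Curve, (x = curve t₁.1 ∨ x = curve t₁.2.1 ∨ x = curve t₁.2.2) →
        (x = curve w.1 ∨ x = curve w.2.1 ∨ x = curve w.2.2) := by
      rcases hu with rfl | rfl | rfl <;> simp only [cnj, rot, curve_conj] <;>
        rintro x (h | h | h) <;> simp only [h, true_or, or_true]
    have key : ∀ a b c : Color, (a ≠ b ∧ b ≠ c ∧ c ≠ a) →
        a + b + c ≠ a ∧ a + b + c ≠ b ∧ a + b + c ≠ c := by decide
    obtain ⟨k1, k2, k3⟩ := key _ _ _ ⟨n1, n2, n3⟩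
    rw [← color_fourth] at k1 k2 k3
    have ne := fun (x y : Curve) (hxy : color x ≠ color y) (e : x = y) => hxy (congrArg color e)
    -- The first three curves of `t₁` can be those of `t₀` only if both triples have the same fourth
    -- curve; the other cases contradict the colours.
    rcases hw with rfl | rfl | rfl | rfl
    · right
      rw [hq]
      rcases hu with rfl | rfl | rfl
      · rw [flp_cnj, quad_cnj]
      · rw [flp_cnj, quad_cnj, flp_rot, quad_rot, quad_rot]
      · rw [flp_cnj, quad_cnj, flp_rot, flp_rot, quad_rot, quad_rot, quad_rot, quad_rot]
    · exfalso
      rcases hmem _ c3 with e | e | e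
      · exact ne _ _ n3 e
      · exact ne _ _ k3.symm (e.trans (curve_fourth_rot t₀))
      · exact ne _ _ n2.symm e
    · exfalso
      rcases hmem _ c1 with e | e | e
      · exact ne _ _ n1 e
      · exact ne _ _ k1.symm (e.trans ((curve_fourth_rot _).trans (curve_fourth_rot t₀)))
      · exact ne _ _ n3.symm e
    · exfalso
      rcases hmem _ c2 with e | e | e
      · exact ne _ _ n2 e
      · exact ne _ _ k2.symm (e.trans ((curve_fourth_rot _).trans
          ((curve_fourth_rot _).trans (curve_fourth_rot t₀))))
      · exact ne _ _ n1.symm e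
  -- At most two of the four curves have trace `4`, too few for three distinct ones.
  · exfalso
    have hpt := hA.pos hp
    have p1 : absTr ρ (curve t.1) = tr (mapT ρ t).1 := abs_of_pos hpt.pos1
    have p2 : absTr ρ (curve t.2.1) = tr (mapT ρ t).2.1 := abs_of_pos hpt.pos2
    have p3 : absTr ρ (curve t.2.2) = tr (mapT ρ t).2.2 := abs_of_pos hpt.pos3
    have p4 : absTr ρ (curve (fourth t)) = tr (fourth (mapT ρ t)) := by
      rw [fourth_mapT]
      exact abs_of_pos (by rw [← fourth_mapT]; exact hpt.pos4)
    have m1 : curve t₀.1 ≠ curve t₀.2.1 := fun e => n1 (congrArg color e)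
    have m2 : curve t₀.2.1 ≠ curve t₀.2.2 := fun e => n2 (congrArg color e)
    have m3 : curve t₀.2.2 ≠ curve t₀.1 := fun e => n3 (congrArg color e)
    obtain ⟨-, -, -, -, s1, s2, s3, s4⟩ := hb
    rw [← p1, ← p2, ← p3] at s1
    rw [← p1, ← p2, ← p4] at s2
    rw [← p1, ← p3, ← p4] at s3
    rw [← p2, ← p3, ← p4] at s4
    rw [mem_quad] at h1 h2 h3
    rcases h1 with e1 | e1 | e1 | e1 <;> rcases h2 with e2 | e2 | e2 | e2 <;>
      first
      | exact m1 (e1.trans e2.symm)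
      | (rcases h3 with e3 | e3 | e3 | e3 <;>
          first
          | exact m2 (e2.trans e3.symm)
          | exact m3 (e3.trans e1.symm)
          | (rw [e1] at w1; rw [e2] at w2; rw [e3] at w3; omega))

end Curves

/-! ### The 1-skeleton: one neighbour for each vertex and colour. -/

section Cells

theorem mem_iff_of_image {v : Set ThreeCell} {q : Set Curve} (h : Subtype.val '' v = q)
    (x : ThreeCell) : x ∈ v ↔ x.1 ∈ q := by
  subst h
  refine ⟨fun hx => ⟨x, hx, rfl⟩, ?_⟩
  rintro ⟨y, hy, e⟩
  exact Subtype.ext e ▸ hy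

/-- The vertex of a triple. -/
def vertexOf (t : Pi1 × Pi1 × Pi1) (h : IsT t) : ZeroCell :=
  ⟨{x | x.1 ∈ quad t}, t.1, t.2.1, t.2.2, h, by
    ext x
    constructor
    · rintro ⟨y, hy, rfl⟩
      exact hy
    · intro hx
      exact ⟨⟨x, _, _, _, h, hx⟩, hx, rfl⟩⟩

theorem mem_vertexOf {t : Pi1 × Pi1 × Pi1} {h : IsT t} {x : ThreeCell} :
    x ∈ (vertexOf t h).1 ↔ x.1 ∈ quad t := Iff.rfl

theorem vertexOf_congr {t u : Pi1 × Pi1 × Pi1} (h : IsT t) (h' : IsT u) (e : quad t = quad u) :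
    vertexOf t h = vertexOf u h' :=
  Subtype.ext (Set.ext fun x => by rw [mem_vertexOf, mem_vertexOf, e])

theorem exists_eq_vertexOf (v : ZeroCell) : ∃ t h, v = vertexOf t h := by
  obtain ⟨A, B, C, h, hv⟩ := v.2
  refine ⟨(A, B, C), h, Subtype.ext (Set.ext fun x => ?_)⟩
  exact mem_iff_of_image hv x

theorem exists_cell (v : ZeroCell) (k : Color) : ∃ x ∈ v.1, color x.1 = k := by
  obtain ⟨t, h, rfl⟩ := exists_eq_vertexOf v
  obtain ⟨x, hx, hk⟩ := color_surj h k
  exact ⟨⟨x, _, _, _, h, hx⟩, hx, hk⟩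

/-- The 3-cell of the given colour at a vertex. -/
noncomputable def cell (v : ZeroCell) (k : Color) : ThreeCell := (exists_cell v k).choose

theorem cell_mem (v : ZeroCell) (k : Color) : cell v k ∈ v.1 := (exists_cell v k).choose_spec.1

theorem color_cell (v : ZeroCell) (k : Color) : color (cell v k).1 = k :=
  (exists_cell v k).choose_spec.2

theorem eq_cell {v : ZeroCell} {x : ThreeCell} (hx : x ∈ v.1) : x = cell v (color x.1) := by
  have h1 := cell_mem v (color x.1)
  have h2 := color_cell v (color x.1)
  obtain ⟨t, h, rfl⟩ := exists_eq_vertexOf v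
  exact Subtype.ext (color_inj h hx h1 h2.symm)

theorem cell_injective (v : ZeroCell) : Function.Injective (cell v) := fun k l h => by
  rw [← color_cell v k, h, color_cell]

theorem range_cell (v : ZeroCell) : Set.range (cell v) = v.1 := by
  ext x
  constructor
  · rintro ⟨k, rfl⟩
    exact cell_mem v k
  · exact fun hx => ⟨_, (eq_cell hx).symm⟩

theorem cell_mem_iff {v w : ZeroCell} {k : Color} : cell v k ∈ w.1 ↔ cell v k = cell w k := by
  constructor
  · intro h
    have := eq_cell h
    rwa [color_cell] at this
  · intro h
    rw [h]
    exact cell_mem w k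

/-- Two vertices differ exactly in the colour `c`. -/
def AdjAt (c : Color) (v w : ZeroCell) : Prop :=
  cell v c ≠ cell w c ∧ ∀ k, k ≠ c → cell v k = cell w k

theorem AdjAt.symm {c : Color} {v w : ZeroCell} (h : AdjAt c v w) : AdjAt c w v :=
  ⟨h.1.symm, fun k hk => (h.2 k hk).symm⟩

theorem inter_eq_image (v w : ZeroCell) : v.1 ∩ w.1 = cell v '' {k | cell v k = cell w k} := by
  ext x
  constructor
  · rintro ⟨hv, hw⟩
    exact ⟨color x.1, (eq_cell hv).symm.trans (eq_cell hw), (eq_cell hv).symm⟩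
  · rintro ⟨k, hk, rfl⟩
    exact ⟨cell_mem v k, cell_mem_iff.mpr hk⟩

theorem ncard_inter (v w : ZeroCell) :
    (v.1 ∩ w.1).ncard + {k | cell v k = cell w k}ᶜ.ncard = 4 := by
  rw [inter_eq_image, Set.ncard_image_of_injective _ (cell_injective v), Set.ncard_add_ncard_compl,
    Nat.card_eq_fintype_card]
  rfl

/-- Cells of two vertices can only coincide colour by colour, so three common cells leave one colour
that differs. -/
theorem adj_iff {v w : ZeroCell} : oneSkeleton.Adj v w ↔ ∃ c, AdjAt c v w := by
  have hcard := ncard_inter v w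
  constructor
  · rintro ⟨-, h3, -⟩
    obtain ⟨c, hc⟩ := Set.ncard_eq_one.mp (show {k | cell v k = cell w k}ᶜ.ncard = 1 by omega)
    have hc' : ∀ k, cell v k ≠ cell w k ↔ k = c := fun k => Set.ext_iff.mp hc k
    exact ⟨c, (hc' c).mpr rfl, fun k hk => by_contra fun h => hk ((hc' k).mp h)⟩
  · rintro ⟨c, h1, h2⟩
    have hc : {k | cell v k = cell w k}ᶜ = {c} := by
      ext k
      refine ⟨fun hk => by_contra fun h => hk (h2 k h), ?_⟩
      rintro rfl
      exact h1
    rw [hc, Set.ncard_singleton] at hcard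
    exact ⟨fun e => h1 (e ▸ rfl), by omega, v.1, v.2, Set.inter_subset_left⟩

/-- Every 3-cell at a vertex is the fourth one of a suitable triple. -/
theorem exists_frame (v : ZeroCell) (c : Color) :
    ∃ t h, v = vertexOf t h ∧ color (curve (fourth t)) = c := by
  obtain ⟨t, h, rfl⟩ := exists_eq_vertexOf v
  obtain ⟨x, hx, rfl⟩ := color_surj h c
  rcases mem_quad.mp hx with rfl | rfl | rfl | rfl
  · refine ⟨exch (rot t), h.rotate.exchange, vertexOf_congr _ _ ?_, ?_⟩
    · rw [quad_exch, quad_rot]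
    · rw [fourth_exch]; rfl
  · refine ⟨exch (rot (rot t)), h.rotate.rotate.exchange, vertexOf_congr _ _ ?_, ?_⟩
    · rw [quad_exch, quad_rot, quad_rot]
    · rw [fourth_exch]; rfl
  · refine ⟨exch t, h.exchange, vertexOf_congr _ _ ?_, ?_⟩
    · rw [quad_exch]
    · rw [fourth_exch]
  · exact ⟨t, h, rfl, rfl⟩

theorem quad_flp_of_ne {t : Pi1 × Pi1 × Pi1} {x : Curve} (hx : x ∈ quad t)
    (hc : color x ≠ color (curve (fourth t))) : x ∈ quad (flp t) := by
  rcases mem_quad.mp hx with rfl | rfl | rfl | rfl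
  · exact Or.inl rfl
  · exact Or.inr (Or.inr (Or.inl rfl))
  · exact Or.inr (Or.inl rfl)
  · exact absurd rfl hc

theorem adjAt_flp {t : Pi1 × Pi1 × Pi1} (h : IsT t) (h' : IsT (flp t)) :
    AdjAt (color (curve (fourth t))) (vertexOf t h) (vertexOf (flp t) h') := by
  constructor
  · intro e
    have hc : color (curve (fourth (flp t))) = color (curve (fourth t)) := by
      rw [color_fourth, color_fourth]
      simp only [flp]
      exact add_right_comm _ _ _
    have h1 : (cell (vertexOf t h) (color (curve (fourth t)))).1 = curve (fourth t) :=
      color_inj h (cell_mem (vertexOf t h) _) (Or.inr (Or.inr (Or.inr rfl))) (color_cell _ _)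
    have h2 : (cell (vertexOf (flp t) h') (color (curve (fourth t)))).1 =
        curve (fourth (flp t)) :=
      color_inj h' (cell_mem (vertexOf (flp t) h') _) (Or.inr (Or.inr (Or.inr rfl)))
        ((color_cell _ _).trans hc.symm)
    rw [← e, h1] at h2
    exact curve_fourth_flp_ne h h2.symm
  · intro k hk
    refine cell_mem_iff.mp (quad_flp_of_ne (cell_mem (vertexOf t h) k) ?_)
    rwa [color_cell]

theorem exists_adjAt (v : ZeroCell) (c : Color) : ∃ w, AdjAt c v w := by
  obtain ⟨t, h, rfl, rfl⟩ := exists_frame v c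
  exact ⟨_, adjAt_flp h h.flip⟩

/-- This is what the growth of traces is for. It makes two successive flips of one colour return to
the start. -/
theorem AdjAt.unique {c : Color} {v w w' : ZeroCell} (h : AdjAt c v w) (h' : AdjAt c v w') :
    w = w' := by
  obtain ⟨t, ht, rfl, rfl⟩ := exists_frame v c
  have key : ∀ {w : ZeroCell}, AdjAt (color (curve (fourth t))) (vertexOf t ht) w →
      w = vertexOf (flp t) ht.flip := by
    intro w hw
    obtain ⟨u, hu, rfl⟩ := exists_eq_vertexOf w
    have hmem : ∀ x ∈ quad t, color x ≠ color (curve (fourth t)) → x ∈ quad u := by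
      intro x hx hc
      have e : (⟨x, _, _, _, ht, hx⟩ : ThreeCell) = _ := eq_cell (v := vertexOf t ht) hx
      rw [hw.2 _ hc] at e
      have := cell_mem (vertexOf u hu) (color x)
      rw [← e] at this
      exact this
    have key : ∀ a b c : Color, (a ≠ b ∧ b ≠ c ∧ c ≠ a) →
        a ≠ a + b + c ∧ b ≠ a + b + c ∧ c ≠ a + b + c := by decide
    obtain ⟨k1, k2, k3⟩ := key _ _ _ (color_ne ht)
    rw [← color_fourth] at k1 k2 k3
    rcases quad_eq_or ht hu (hmem _ (Or.inl rfl) k1) (hmem _ (Or.inr (Or.inl rfl)) k2)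
      (hmem _ (Or.inr (Or.inr (Or.inl rfl))) k3) with e | e
    · exact absurd (by rw [vertexOf_congr hu ht e]) hw.1
    · exact vertexOf_congr _ _ e
  rw [key h, key h']

theorem oneSkeleton_connected : oneSkeleton.Connected := by
  have key : ∀ {A B C : Pi1} (h : IsOneSidedTriple A B C),
      oneSkeleton.Reachable (vertexOf (FreeGroup.of 0, FreeGroup.of 1, FreeGroup.of 2)
        IsOneSidedTriple.base) (vertexOf (A, B, C) h) := by
    intro A B C h
    induction h with
    | base => exact SimpleGraph.Reachable.refl _
    | @rotate A B C h ih =>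
      have e : vertexOf (A, B, C) h = vertexOf (B, C, A) h.rotate :=
        vertexOf_congr (t := (A, B, C)) (u := rot (A, B, C)) h h.rotate (quad_rot _).symm
      exact e ▸ ih
    | @exchange A B C h ih =>
      have e : vertexOf (A, B, C) h = vertexOf (A, (B * C * A)⁻¹, B) h.exchange :=
        vertexOf_congr (t := (A, B, C)) (u := exch (A, B, C)) h h.exchange (quad_exch _).symm
      exact e ▸ ih
    | @flip A B C h ih =>
      exact ih.trans (adj_iff.mpr ⟨_, adjAt_flp (t := (A, B, C)) h h.flip⟩).reachable
  rw [SimpleGraph.connected_iff]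
  refine ⟨fun v w => ?_, ⟨vertexOf (_, _, _) IsOneSidedTriple.base⟩⟩
  obtain ⟨t, ht, rfl⟩ := exists_eq_vertexOf v
  obtain ⟨u, hu, rfl⟩ := exists_eq_vertexOf w
  exact (key ht).symm.trans (key hu)

/-- The four colours, in some order. -/
def FourColors (a b c d : Color) : Prop :=
  a ≠ b ∧ a ≠ c ∧ a ≠ d ∧ b ≠ c ∧ b ≠ d ∧ c ≠ d

instance (a b c d : Color) : Decidable (FourColors a b c d) := by
  unfold FourColors; infer_instance

theorem FourColors.univ_eq {a b c d : Color} (h : FourColors a b c d) :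
    (Finset.univ : Finset Color) = {a, b, c, d} := by
  revert a b c d
  decide

theorem FourColors.cases {a b c d : Color} (h : FourColors a b c d) (k : Color) :
    k = a ∨ k = b ∨ k = c ∨ k = d := by
  have := Finset.mem_univ k
  rw [h.univ_eq] at this
  simpa using this

theorem FourColors.sum_eq {a b c d : Color} (h : FourColors a b c d) (f : Color → ℂ) :
    ∑ k, f k = f a + f b + f c + f d := by
  obtain ⟨h1, h2, h3, h4, h5, h6⟩ := id h
  rw [h.univ_eq, Finset.sum_insert (by simp [*]), Finset.sum_insert (by simp [*]),
    Finset.sum_insert (by simp [*]), Finset.sum_singleton]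
  ring

theorem exists_fourColors (a : Color) : ∃ b c d, FourColors a b c d := by
  revert a; decide

theorem exists_fourColors_of_ne {a b : Color} (h : a ≠ b) : ∃ c d, FourColors a b c d := by
  revert a b; decide

theorem exists_fourColors_of_ne_of_ne {a b c : Color} (h1 : a ≠ b) (h2 : a ≠ c) (h3 : b ≠ c) :
    ∃ d, FourColors a b c d := by
  revert a b c; decide

theorem FourColors.set_eq {a b c d : Color} (h : FourColors a b c d) (v : ZeroCell) :
    ({cell v a, cell v b, cell v c, cell v d} : Set ThreeCell) = v.1 := by
  rw [← range_cell]
  ext x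
  simp only [Set.mem_insert_iff, Set.mem_singleton_iff, Set.mem_range]
  constructor
  · rintro (rfl | rfl | rfl | rfl) <;> exact ⟨_, rfl⟩
  · rintro ⟨k, rfl⟩
    rcases h.cases k with rfl | rfl | rfl | rfl <;> simp

variable {φ : ThreeCell → ℂ}

/-- The sum of the values of a Markoff map at a vertex. -/
noncomputable def vsum (φ : ThreeCell → ℂ) (v : ZeroCell) : ℂ := ∑ k, φ (cell v k)

theorem IsMarkoffMap.vsum_sq (hφ : IsMarkoffMap φ) {a b c d : Color} (h : FourColors a b c d)
    (v : ZeroCell) :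
    vsum φ v ^ 2 = φ (cell v a) * φ (cell v b) * φ (cell v c) * φ (cell v d) := by
  rw [vsum, h.sum_eq]
  apply hφ.vertex
  rw [h.set_eq]
  exact v.2

theorem IsMarkoffMap.vsum_add (hφ : IsMarkoffMap φ) {a b c d : Color} (h : FourColors a b c d)
    {v w : ZeroCell} (hvw : AdjAt a v w) :
    vsum φ v + vsum φ w = φ (cell v b) * φ (cell v c) * φ (cell v d) := by
  obtain ⟨h1, h2, h3, h4, h5, h6⟩ := id h
  have h' : FourColors b c d a := ⟨h4, h5, h1.symm, h6, h2.symm, h3.symm⟩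
  rw [vsum, vsum, h'.sum_eq, h'.sum_eq, ← hvw.2 b h1.symm, ← hvw.2 c h2.symm, ← hvw.2 d h3.symm]
  apply hφ.edge
  · rw [h'.set_eq]; exact v.2
  · rw [hvw.2 b h1.symm, hvw.2 c h2.symm, hvw.2 d h3.symm, h'.set_eq]; exact w.2
  · exact hvw.1

end Cells

/-! ### Asymptotics of an infinite descent. -/

section Descent

open Filter Topology

/-- The values of a Markoff map along an infinite path which never increases them, under the
assumption that all values exceed `2`: at the `n`-th step the value of colour `i n` is flipped. -/
structure Descent (f : ℕ → Color → ℂ) (s : ℕ → ℂ) (i : ℕ → Color) : Prop where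
  two_lt : ∀ n k, 2 < ‖f n k‖
  sum : ∀ n a b c d, FourColors a b c d → s n = f n a + f n b + f n c + f n d
  sq : ∀ n a b c d, FourColors a b c d → s n ^ 2 = f n a * f n b * f n c * f n d
  fix : ∀ n k, k ≠ i n → f (n + 1) k = f n k
  flip : ∀ n b c d, FourColors (i n) b c d → s n + s (n + 1) = f n b * f n c * f n d
  le : ∀ n, ‖f (n + 1) (i n)‖ ≤ ‖f n (i n)‖
  ne : ∀ n, i (n + 1) ≠ i n

theorem norm_vsum_sq_gt {s a b c d : ℂ} (h : s ^ 2 = a * b * c * d) (ha : 2 < ‖a‖) (hb : 2 < ‖b‖)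
    (hc : 2 < ‖c‖) (hd : 2 < ‖d‖) : 8 * ‖d‖ < ‖s‖ ^ 2 := by
  rw [← norm_pow, h, norm_mul, norm_mul, norm_mul]
  have h1 : 4 < ‖a‖ * ‖b‖ := by nlinarith
  have h2 : 8 < ‖a‖ * ‖b‖ * ‖c‖ := by nlinarith
  nlinarith

/-- The product of the two proportions is `1 / (c * d)`. -/
theorem norm_div_mul_norm_div_lt {s a b c d : ℂ} (h : s ^ 2 = a * b * c * d) (ha : 2 < ‖a‖)
    (hb : 2 < ‖b‖) (hc : 2 < ‖c‖) (hd : 2 < ‖d‖) : ‖a / s‖ * ‖b / s‖ < 1 / 4 := by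
  have h0 := norm_vsum_sq_gt h ha hb hc hd
  have h1 : ‖s‖ ^ 2 = ‖a‖ * ‖b‖ * ‖c‖ * ‖d‖ := by
    rw [← norm_pow, h, norm_mul, norm_mul, norm_mul]
  rw [norm_div, norm_div, div_mul_div_comm, ← sq, h1, div_lt_div_iff₀ (by positivity) (by norm_num)]
  have h2 : 4 < ‖c‖ * ‖d‖ := by nlinarith
  have h3 : 0 < ‖a‖ * ‖b‖ := by positivity
  nlinarith

/-- If the flip at a value does not increase it, then its proportion has real part at least
`1 / 2`. -/
theorem half_le_re_div {s s' a a' p : ℂ} (hs : s ≠ 0) (ha : a ≠ 0) (hsq : s ^ 2 = p * a)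
    (hadd : s + s' = p) (ha' : a' = a + (s' - s)) (hle : ‖a'‖ ≤ ‖a‖) : 1 / 2 ≤ (a / s).re := by
  set x := a / s with hx
  have hx0 : x ≠ 0 := div_ne_zero ha hs
  have ha1 : a = x * s := by rw [hx]; field_simp
  have h1 : s' * x = s * (1 - x) := by
    have : s * (s - (s + s') * x) = 0 := by
      rw [hadd]; linear_combination hsq + p * ha1
    have := (mul_eq_zero.mp this).resolve_left hs
    linear_combination -this
  have h2 : a' * x = s * (1 - x) ^ 2 := by
    rw [ha', ha1]; linear_combination (1 : ℂ) * h1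
  have h3 : ‖1 - x‖ ^ 2 ≤ ‖x‖ ^ 2 := by
    have e := congrArg norm h2
    rw [norm_mul, norm_mul, norm_pow] at e
    have e' := congrArg norm ha1
    rw [norm_mul] at e'
    have hs' : 0 < ‖s‖ := norm_pos_iff.mpr hs
    have : ‖s‖ * ‖1 - x‖ ^ 2 ≤ ‖s‖ * ‖x‖ ^ 2 := by
      rw [← e]
      calc ‖a'‖ * ‖x‖ ≤ ‖a‖ * ‖x‖ := by gcongr
        _ = ‖s‖ * ‖x‖ ^ 2 := by rw [e']; ring
    exact le_of_mul_le_mul_left this hs'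
  rw [← Complex.normSq_eq_norm_sq, ← Complex.normSq_eq_norm_sq, Complex.normSq_apply,
    Complex.normSq_apply] at h3
  simp only [Complex.sub_re, Complex.sub_im, Complex.one_re, Complex.one_im] at h3
  linarith

theorem half_le_norm_of_re {x : ℂ} (h : 1 / 2 ≤ x.re) : 1 / 2 ≤ ‖x‖ :=
  h.trans (Complex.re_le_norm x)

variable {f : ℕ → Color → ℂ} {s : ℕ → ℂ} {i : ℕ → Color}

namespace Descent

theorem f_ne (h : Descent f s i) (n : ℕ) (k : Color) : f n k ≠ 0 :=
  norm_pos_iff.mp (by linarith [h.two_lt n k])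

theorem norm_f_lt (h : Descent f s i) (n : ℕ) (k : Color) : 8 * ‖f n k‖ < ‖s n‖ ^ 2 := by
  obtain ⟨b, c, d, h'⟩ := exists_fourColors k
  refine norm_vsum_sq_gt (a := f n b) (b := f n c) (c := f n d) ?_ (h.two_lt n b) (h.two_lt n c)
    (h.two_lt n d) (h.two_lt n k)
  rw [h.sq n k b c d h']; ring

theorem four_lt (h : Descent f s i) (n : ℕ) : 4 < ‖s n‖ := by
  have h1 := h.norm_f_lt n (i n)
  have h2 := h.two_lt n (i n)
  nlinarith [norm_nonneg (s n)]

theorem s_ne (h : Descent f s i) (n : ℕ) : s n ≠ 0 :=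
  norm_pos_iff.mp (by linarith [h.four_lt n])

theorem sum_x (h : Descent f s i) (n : ℕ) {a b c d : Color} (h' : FourColors a b c d) :
    f n a / s n + f n b / s n + f n c / s n + f n d / s n = 1 := by
  rw [← add_div, ← add_div, ← add_div, ← h.sum n a b c d h', div_self (h.s_ne n)]

theorem pair_eq (h : Descent f s i) (n : ℕ) {a b c d : Color} (h' : FourColors a b c d) :
    f n a / s n * (f n b / s n) * (f n c * f n d) = 1 := by
  have := h.s_ne n
  have h1 := h.sq n a b c d h'
  rw [div_mul_div_comm, ← pow_two (s n), h1]
  have := h.f_ne n a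
  have := h.f_ne n b
  have := h.f_ne n c
  have := h.f_ne n d
  field_simp

theorem pair_lt (h : Descent f s i) (n : ℕ) {a b : Color} (hab : a ≠ b) :
    ‖f n a / s n‖ * ‖f n b / s n‖ < 1 / 4 := by
  obtain ⟨c, d, h'⟩ := exists_fourColors_of_ne hab
  exact norm_div_mul_norm_div_lt (h.sq n a b c d h') (h.two_lt n a) (h.two_lt n b) (h.two_lt n c)
    (h.two_lt n d)

theorem s_succ (h : Descent f s i) (n : ℕ) :
    s (n + 1) * (f n (i n) / s n) = s n * (1 - f n (i n) / s n) := by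
  obtain ⟨b, c, d, h'⟩ := exists_fourColors (i n)
  have h1 := h.sq n _ b c d h'
  have h2 := h.flip n b c d h'
  have h3 := h.s_ne n
  field_simp
  linear_combination f n (i n) * h2 - h1

theorem f_succ (h : Descent f s i) (n : ℕ) :
    f (n + 1) (i n) = f n (i n) + (s (n + 1) - s n) := by
  obtain ⟨b, c, d, h'⟩ := exists_fourColors (i n)
  obtain ⟨h1, h2, h3, -⟩ := id h'
  rw [h.sum n _ b c d h', h.sum (n + 1) _ b c d h', h.fix n b h1.symm, h.fix n c h2.symm,
    h.fix n d h3.symm]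
  ring

theorem x_succ (h : Descent f s i) (n : ℕ) :
    f (n + 1) (i n) / s (n + 1) = 1 - f n (i n) / s n := by
  rw [div_eq_iff (h.s_ne _)]
  have h1 := h.s_succ n
  have h2 := h.f_succ n
  have h3 : f n (i n) / s n * s n = f n (i n) := div_mul_cancel₀ _ (h.s_ne n)
  linear_combination h2 - h3 + h1

theorem half_le_re (h : Descent f s i) (n : ℕ) : 1 / 2 ≤ (f n (i n) / s n).re := by
  obtain ⟨b, c, d, h'⟩ := exists_fourColors (i n)
  refine half_le_re_div (h.s_ne n) (h.f_ne n _) ?_ (h.flip n b c d h') (h.f_succ n) (h.le n)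
  rw [h.sq n _ b c d h']; ring

/-- After the flip this colour has proportion `1 - x`, while the colour flipped next has proportion
at least `1/2`; their product is below `1/4`. -/
theorem norm_one_sub_lt (h : Descent f s i) (n : ℕ) : ‖1 - f n (i n) / s n‖ < 1 / 2 := by
  have h1 := h.pair_lt (n + 1) (h.ne n).symm
  rw [h.x_succ] at h1
  have h2 := half_le_norm_of_re (h.half_le_re (n + 1))
  nlinarith [norm_nonneg (1 - f n (i n) / s n)]

theorem norm_s_succ (h : Descent f s i) (n : ℕ) :
    ‖s (n + 1)‖ * ‖f n (i n) / s n‖ = ‖s n‖ * ‖1 - f n (i n) / s n‖ := by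
  rw [← norm_mul, ← norm_mul, h.s_succ]

theorem antitone_norm_s (h : Descent f s i) : Antitone fun n => ‖s n‖ := by
  refine antitone_nat_of_succ_le fun n => ?_
  have h1 := h.norm_s_succ n
  have h2 := half_le_norm_of_re (h.half_le_re n)
  have h3 := h.norm_one_sub_lt n
  have h4 := h.four_lt n
  by_contra hcon
  push Not at hcon
  nlinarith

theorem norm_f_le (h : Descent f s i) (n : ℕ) (k : Color) : ‖f n k‖ ≤ ‖f 0 k‖ := by
  induction n with
  | zero => exact le_rfl
  | succ n ih =>
    by_cases hk : k = i n
    · subst hk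
      exact (h.le n).trans ih
    · rw [h.fix n k hk]; exact ih

/-- `‖s n‖` converges to a limit at least `4`, so `‖x‖ / ‖1 - x‖`, the ratio of successive terms,
tends to `1`. Together with `‖1 - x‖ < 1/2 ≤ Re x` this forces `x` to `1/2`. -/
theorem tendsto_half (h : Descent f s i) :
    Tendsto (fun n => f n (i n) / s n) atTop (𝓝 (1 / 2)) := by
  obtain ⟨L, hL⟩ : ∃ L, Tendsto (fun n => ‖s n‖) atTop (𝓝 L) :=
    ⟨_, tendsto_atTop_ciInf h.antitone_norm_s ⟨0, by rintro _ ⟨n, rfl⟩; exact norm_nonneg _⟩⟩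
  have hL4 : 4 ≤ L := ge_of_tendsto' hL fun n => (h.four_lt n).le
  have hr : Tendsto (fun n => ((‖s n‖ / ‖s (n + 1)‖) ^ 2 - 1) / 8) atTop (𝓝 0) := by
    have := (((hL.div (hL.comp (tendsto_add_atTop_nat 1)) (by linarith)).pow 2).sub_const 1).div_const
      (8 : ℝ)
    rwa [div_self (by linarith), one_pow, sub_self, zero_div] at this
  have hsq : Tendsto (fun n => ‖f n (i n) / s n - 1 / 2‖ ^ 2) atTop (𝓝 0) := by
    refine squeeze_zero (fun n => by positivity) (fun n => ?_) hr
    set X := f n (i n) / s n with hX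
    have h1 := h.norm_s_succ n
    have h2 := h.norm_one_sub_lt n
    have h3 := half_le_norm_of_re (h.half_le_re n)
    have h4 := h.four_lt n
    have h5 := h.four_lt (n + 1)
    rw [← hX] at h1 h2 h3
    have h6 : ‖X‖ = ‖s n‖ / ‖s (n + 1)‖ * ‖1 - X‖ := by
      rw [div_mul_eq_mul_div, ← h1]; field_simp
    -- Parallelogram identity; with `‖X‖ = r * ‖1 - X‖` and `‖1 - X‖ ≤ 1/2` it gives the bound `(r ^
    -- 2 - 1) / 8`.
    have h7 : ‖X - 1 / 2‖ ^ 2 = (‖X‖ ^ 2 + ‖1 - X‖ ^ 2) / 2 - 1 / 4 := by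
      rw [← Complex.normSq_eq_norm_sq, ← Complex.normSq_eq_norm_sq, ← Complex.normSq_eq_norm_sq,
        Complex.normSq_apply, Complex.normSq_apply, Complex.normSq_apply]
      simp
      ring
    rw [h7, h6]
    set r := ‖s n‖ / ‖s (n + 1)‖
    have h8 : ‖1 - X‖ ^ 2 ≤ 1 / 4 := by nlinarith [norm_nonneg (1 - X)]
    have h9 : 0 ≤ r ^ 2 + 1 := by positivity
    nlinarith
  rw [tendsto_iff_norm_sub_tendsto_zero]
  have := hsq.sqrt
  simpa [Real.sqrt_sq] using this

/-- A flip multiplies the other proportions by `s n / s (n + 1) = x / (1 - x)`, which tends to `1`,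
and replaces the flipped one by `1 - x`. -/
theorem tendsto_diff (h : Descent f s i) (k : Color) :
    Tendsto (fun n => ‖f (n + 1) k / s (n + 1) - f n k / s n‖) atTop (𝓝 0) := by
  have hX := h.tendsto_half
  have h1 : Tendsto (fun n => ‖f 0 k‖ * ‖(f n (i n) / s n) / (1 - f n (i n) / s n) - 1‖ +
      ‖1 - 2 * (f n (i n) / s n)‖) atTop (𝓝 0) := by
    have a := (((hX.div (hX.const_sub 1) (by norm_num)).sub_const 1).norm.const_mul ‖f 0 k‖).add
      ((hX.const_mul 2).const_sub 1).norm
    norm_num at a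
    simpa using a
  refine squeeze_zero (fun n => norm_nonneg _) (fun n => ?_) h1
  set X := f n (i n) / s n with hXdef
  by_cases hk : k = i n
  · subst hk
    rw [h.x_succ, ← hXdef, show 1 - X - X = 1 - 2 * X by ring]
    exact le_add_of_nonneg_left (by positivity)
  · have h2 := h.s_succ n
    rw [← hXdef] at h2
    have hs := h.s_ne n
    have hs' := h.s_ne (n + 1)
    have hX0 : X ≠ 0 := div_ne_zero (h.f_ne n _) hs
    have h1X : 1 - X ≠ 0 := by
      intro h0
      rw [h0, mul_zero] at h2
      exact (mul_ne_zero hs' hX0) h2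
    have h3 : f (n + 1) k / s (n + 1) - f n k / s n = f n k / s n * (X / (1 - X) - 1) := by
      rw [h.fix n k hk]
      have : X / (1 - X) = s n / s (n + 1) := by
        rw [div_eq_div_iff h1X hs']; linear_combination h2
      rw [this]
      field_simp
    rw [h3, norm_mul]
    refine le_add_of_le_of_nonneg ?_ (norm_nonneg _)
    gcongr
    rw [norm_div]
    exact (div_le_self (norm_nonneg _) (by linarith [h.four_lt n])).trans (h.norm_f_le n k)

/-- Every colour is flipped infinitely often. -/
theorem exists_flip (h : Descent f s i) (k : Color) (N : ℕ) : ∃ n ≥ N, i n = k := by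
  by_contra hcon
  push Not at hcon
  have hconst : ∀ n ≥ N, f n k = f N k := by
    intro n hn
    induction n, hn using Nat.le_induction with
    | base => rfl
    | succ n hn ih => rw [h.fix n k (hcon n hn).symm, ih]
  have hX := h.tendsto_half
  -- The two colours flipped at `n` and `n + 1` have proportions with product tending to `1/4`. That
  -- product is the reciprocal of the other two values, one of them fixed and larger than `2`.
  have hlim : Tendsto (fun n => ‖1 - f n (i n) / s n‖ * ‖f (n + 1) (i (n + 1)) / s (n + 1)‖) atTop
      (𝓝 (1 / 4)) := by
    have := (hX.const_sub 1).norm.mul (hX.comp (tendsto_add_atTop_nat 1)).norm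
    norm_num at this
    simpa using this
  have hβ := h.two_lt N k
  have hle : ∀ᶠ n in atTop, ‖1 - f n (i n) / s n‖ * ‖f (n + 1) (i (n + 1)) / s (n + 1)‖ ≤
      1 / (2 * ‖f N k‖) := by
    filter_upwards [eventually_ge_atTop N] with n hn
    obtain ⟨d, hd⟩ := exists_fourColors_of_ne_of_ne (h.ne n).symm (hcon n hn)
      (hcon (n + 1) (by omega))
    have h1 := congrArg norm (h.pair_eq (n + 1) hd)
    rw [h.x_succ, hconst (n + 1) (by omega), norm_mul, norm_mul, norm_mul, norm_one] at h1
    have h2 := h.two_lt (n + 1) d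
    rw [le_div_iff₀ (by positivity)]
    rw [← h1]
    gcongr ?_ * ?_
    rw [mul_comm]
    gcongr
  have h4 := le_of_tendsto hlim hle
  rw [div_le_div_iff₀ (by norm_num) (by positivity)] at h4
  linarith

/-- Three distinct colours are flipped consecutively infinitely often. -/
theorem exists_three (h : Descent f s i) (N : ℕ) : ∃ n ≥ N, i (n + 2) ≠ i n := by
  by_contra hcon
  push Not at hcon
  -- Otherwise the flips alternate between two colours for ever and `c` is never flipped again.
  obtain ⟨c, d, h'⟩ := exists_fourColors_of_ne (h.ne N).symm
  have : ∀ m, i (N + m) = i N ∧ i (N + m + 1) = i (N + 1) ∨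
      i (N + m) = i (N + 1) ∧ i (N + m + 1) = i N := by
    intro m
    induction m with
    | zero => exact Or.inl ⟨rfl, rfl⟩
    | succ m ih =>
      have := hcon (N + m) (by omega)
      rcases ih with ⟨h1, h2⟩ | ⟨h1, h2⟩
      · exact Or.inr ⟨h2, this.trans h1⟩
      · exact Or.inl ⟨h2, this.trans h1⟩
  obtain ⟨n, hn, hc⟩ := h.exists_flip c N
  obtain ⟨m, rfl⟩ := Nat.exists_eq_add_of_le hn
  obtain ⟨-, h1, -, h2, -⟩ := h'
  rcases this m with ⟨h3, -⟩ | ⟨h3, -⟩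
  · exact h1 (h3.symm.trans hc)
  · exact h2 (h3.symm.trans hc)

end Descent

end Descent

/-! ### Near rotations of `s`, and the end of the descent. -/

section Rotation

open Filter Topology

/-- A sequence which passes from below `L` to above `H` does so on an interval on which it stays
strictly between `L` and `H`. -/
theorem exists_crossing (g : ℕ → ℝ) {L H : ℝ} (hLH : L < H) {m n : ℕ} (hmn : m ≤ n)
    (hm : g m ≤ L) (hn : H ≤ g n) : ∃ p q, m ≤ p ∧ p < q ∧ q ≤ n ∧ g p ≤ L ∧ H ≤ g q ∧
      ∀ k, p < k → k < q → L < g k ∧ g k < H := by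
  induction hd : n - m using Nat.strong_induction_on generalizing m n with
  | _ d ih =>
    by_cases hk : ∀ k, m < k → k < n → L < g k ∧ g k < H
    · refine ⟨m, n, le_rfl, lt_of_le_of_ne hmn ?_, le_rfl, hm, hn, hk⟩
      rintro rfl
      linarith
    · push Not at hk
      obtain ⟨k, hmk, hkn, hk⟩ := hk
      rcases le_or_gt (g k) L with h | h
      · obtain ⟨p, q, h1, h2⟩ := ih (n - k) (by omega) hkn.le h hn rfl
        exact ⟨p, q, by omega, h2⟩
      · obtain ⟨p, q, h1, h2, h3, h4⟩ := ih (k - m) (by omega) hmk.le hm (hk h) rfl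
        exact ⟨p, q, h1, h2, by omega, h4⟩

/-- `Re (z ^ 2) = 2 * (Re z) ^ 2 - ‖z‖ ^ 2`, and `(Re z) ^ 2 < ‖z‖ ^ 2 / 16`. -/
theorem re_sq_le {z : ℂ} (h0 : 0 ≤ z.re) (h : 4 * z.re < ‖z‖) :
    (z ^ 2).re ≤ -(7 / 8) * ‖z‖ ^ 2 := by
  have h1 : ‖z‖ ^ 2 = z.re * z.re + z.im * z.im := by
    rw [← Complex.normSq_eq_norm_sq, Complex.normSq_apply]
  have h2 : (z ^ 2).re = z.re * z.re - z.im * z.im := by rw [pow_two, Complex.mul_re]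
  nlinarith [norm_nonneg z]

/-- Two steps of the same linear recurrence cannot both be almost rotations, if they take place at
almost opposite points. -/
theorem not_opposite_rotations {E l ξ ξ' y y' : ℂ} (hE : 0 < E.re)
    (h1 : E = 4 * ξ ^ 2 + 4 * l * ((1 / 2 + ξ) * y))
    (h2 : E = 4 * ξ' ^ 2 + 4 * l * ((1 / 2 + ξ') * y'))
    (hξ0 : 0 ≤ ξ.re) (hξ : 4 * ξ.re < ‖ξ‖) (hξ0' : 0 ≤ ξ'.re) (hξ' : 4 * ξ'.re < ‖ξ'‖)
    (hy : ‖(1 / 2 + ξ) * y + (1 / 2 + ξ') * y'‖ ≤ 9 / 10 * ‖(1 / 2 + ξ) * y‖) : False := by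
  set V := 4 * l * ((1 / 2 + ξ) * y) with hV
  set V' := 4 * l * ((1 / 2 + ξ') * y') with hV'
  have hVV : ‖V + V'‖ ≤ 9 / 10 * ‖V‖ := by
    rw [hV, hV', ← mul_add, norm_mul, norm_mul (4 * l)]
    nlinarith [norm_nonneg (4 * l)]
  clear_value V V'
  have a1 := re_sq_le hξ0 hξ
  have a2 := re_sq_le hξ0' hξ'
  have a3 : 2 * E.re = 4 * (ξ ^ 2).re + 4 * (ξ' ^ 2).re + (V + V').re := by
    have e1 := congrArg Complex.re h1
    have e2 := congrArg Complex.re h2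
    have e3 : ∀ z : ℂ, (4 * z).re = 4 * z.re := fun z => by simp
    rw [Complex.add_re, e3] at e1 e2
    rw [Complex.add_re]
    linarith
  have a4 : (V + V').re ≤ 9 / 10 * ‖V‖ := (Complex.re_le_norm _).trans hVV
  have a5 : ‖V - V'‖ ≤ 4 * ‖ξ‖ ^ 2 + 4 * ‖ξ'‖ ^ 2 := by
    have : V - V' = 4 * ξ' ^ 2 - 4 * ξ ^ 2 := by linear_combination h2 - h1
    rw [this]
    refine (norm_sub_le _ _).trans (le_of_eq ?_)
    rw [norm_mul, norm_mul, norm_pow, norm_pow]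
    norm_num
    ring
  have a6 : 2 * ‖V‖ ≤ ‖V - V'‖ + ‖V + V'‖ := by
    have : 2 * ‖V‖ = ‖(V - V') + (V + V')‖ := by
      rw [show (V - V') + (V + V') = 2 * V by ring, norm_mul]; norm_num
    rw [this]
    exact norm_add_le _ _
  -- With `T = ‖ξ‖ ^ 2 + ‖ξ'‖ ^ 2`, `a5` and `a6` give `11/10 * ‖V‖ ≤ 4 * T`, so `9/10 * ‖V‖ ≤ 7/2 *
  -- T`, whereas `0 < 2 * Re E ≤ 9/10 * ‖V‖ - 7/2 * T`.
  nlinarith [norm_nonneg V]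

namespace Descent

variable {f : ℕ → Color → ℂ} {s : ℕ → ℂ} {i : ℕ → Color}

theorem shift (h : Descent f s i) (m : ℕ) :
    Descent (fun n => f (n + m)) (fun n => s (n + m)) (fun n => i (n + m)) where
  two_lt n := h.two_lt (n + m)
  sum n := h.sum (n + m)
  sq n := h.sq (n + m)
  fix n k hk := by
    have := h.fix (n + m) k hk
    rwa [add_right_comm] at this
  flip n b c d h' := by
    have := h.flip (n + m) b c d h'
    rwa [add_right_comm] at this
  le n := by
    have := h.le (n + m)
    rwa [add_right_comm] at this
  ne n := by
    have := h.ne (n + m)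
    rwa [add_right_comm] at this

/-- A step which is not almost a rotation moves `s` by a bounded multiple of the decrease of its
absolute value. -/
theorem norm_s_sub_le (h : Descent f s i) (n : ℕ)
    (hn : ‖f n (i n) / s n - 1 / 2‖ ≤ 4 * (f n (i n) / s n - 1 / 2).re)
    (h1 : ‖f n (i n) / s n‖ ≤ 1) : ‖s (n + 1) - s n‖ ≤ 8 * (‖s n‖ - ‖s (n + 1)‖) := by
  have e1 := h.s_succ n
  have e2 := h.norm_s_succ n
  have e3 := h.norm_one_sub_lt n
  have e4 := half_le_norm_of_re (h.half_le_re n)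
  have e5 := h.four_lt n
  set X := f n (i n) / s n with hX
  have e6 : ‖s (n + 1) - s n‖ * ‖X‖ = ‖s n‖ * (2 * ‖X - 1 / 2‖) := by
    rw [← norm_mul, show (s (n + 1) - s n) * X = s n * (-2 * (X - 1 / 2)) by
      linear_combination e1, norm_mul, norm_mul]
    norm_num
  have e7 : (‖X‖ - ‖1 - X‖) * (‖X‖ + ‖1 - X‖) = 2 * (X - 1 / 2).re := by
    have : (‖X‖ - ‖1 - X‖) * (‖X‖ + ‖1 - X‖) = ‖X‖ ^ 2 - ‖1 - X‖ ^ 2 := by ring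
    rw [this, ← Complex.normSq_eq_norm_sq, ← Complex.normSq_eq_norm_sq, Complex.normSq_apply,
      Complex.normSq_apply]
    simp
    ring
  -- The sum `‖X‖ + ‖1 - X‖` is at most `2`. So the loss of modulus is controlled below by `Re (X -
  -- 1/2)`, while `s` moves in proportion to `2 * ‖X - 1/2‖`.
  have e8 : (X - 1 / 2).re ≤ ‖X‖ - ‖1 - X‖ := by
    have e9 : 0 ≤ ‖X‖ - ‖1 - X‖ := by linarith
    nlinarith
  refine le_of_mul_le_mul_right ?_ (show 0 < ‖X‖ by linarith)
  rw [e6, mul_assoc, sub_mul, e2, ← mul_sub]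
  nlinarith

/-- While the value of the colour `c` stays constant and its proportion moves, some step is almost a
rotation. -/
theorem exists_rotation (h : Descent f s i) (hX : ∀ n, ‖f n (i n) / s n‖ ≤ 1)
    (hs : ∀ n, ‖s n‖ < 401 / 100) {p q : ℕ} (hpq : p < q) {c : Color}
    (hc : ∀ n, p < n → n ≤ q → f n c = f (p + 1) c)
    (hg : 15 / 1000 ≤ (f q c / s q).re - (f (p + 1) c / s (p + 1)).re) :
    ∃ n, p < n ∧ n < q ∧
      4 * (f n (i n) / s n - 1 / 2).re < ‖f n (i n) / s n - 1 / 2‖ := by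
  by_contra hcon
  push Not at hcon
  -- Without rotations the movement of `s` telescopes against the loss of its modulus, which has
  -- less than `401/100 - 4` to spend.
  have key : ∀ n, p + 1 ≤ n → n ≤ q →
      ‖s n - s (p + 1)‖ ≤ 8 * (‖s (p + 1)‖ - ‖s n‖) := by
    intro n hn
    induction n, hn using Nat.le_induction with
    | base => intro; simp
    | succ n hn ih =>
      intro hnq
      have h1 := ih (by omega)
      have h2 := h.norm_s_sub_le n (hcon n (by omega) (by omega)) (hX n)
      have h3 := norm_add_le (s (n + 1) - s n) (s n - s (p + 1))
      rw [sub_add_sub_cancel] at h3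
      linarith
  have h1 := key q hpq le_rfl
  have h2 := hs (p + 1)
  have h3 := h.four_lt q
  have h3' := h.four_lt (p + 1)
  have h4 := hc q hpq le_rfl
  have h5 : f q c / s q - f (p + 1) c / s (p + 1) =
      -(f (p + 1) c * (s q - s (p + 1))) / (s q * s (p + 1)) := by
    rw [h4]
    have := h.s_ne q
    have := h.s_ne (p + 1)
    field_simp
    ring
  have h6 : 15 / 1000 ≤ ‖f q c / s q - f (p + 1) c / s (p + 1)‖ := by
    rw [← Complex.sub_re] at hg
    exact hg.trans (Complex.re_le_norm _)
  rw [h5, norm_div, norm_neg, norm_mul, norm_mul, le_div_iff₀ (by positivity)] at h6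
  have h7 := h.norm_f_lt (p + 1) c
  have h8 : ‖f (p + 1) c‖ < 202 / 100 := by nlinarith [norm_nonneg (s (p + 1))]
  have h9 : ‖s q - s (p + 1)‖ ≤ 8 / 100 := by linarith
  have h10 : 16 ≤ ‖s q‖ * ‖s (p + 1)‖ := by nlinarith
  -- The proportion moves by at most `202/100 * 8/100 / 16`, about `0.0101`, less than the required
  -- `15/1000`.
  nlinarith [norm_nonneg (f (p + 1) c), norm_nonneg (s q - s (p + 1))]

/-- A descent whose steps are small and whose sum `s` is almost constant in absolute value cannot
pass through a half-turn. -/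
theorem no_half_turn (h : Descent f s i)
    (hX : ∀ n, ‖f n (i n) / s n - 1 / 2‖ < 1 / 10000)
    (hd : ∀ n k, ‖f (n + 1) k / s (n + 1) - f n k / s n‖ < 1 / 10000)
    (hs : ∀ n, ‖s n‖ < 401 / 100) (c : Color) (h0 : (f 0 c / s 0).re ≤ -(48 / 100)) : False := by
  have hreX : ∀ n, |(f n (i n) / s n).re - 1 / 2| < 1 / 10000 := fun n => by
    have := (Complex.abs_re_le_norm _).trans_lt (hX n)
    simpa using this
  have hred : ∀ n k, |(f (n + 1) k / s (n + 1)).re - (f n k / s n).re| < 1 / 10000 := fun n k => by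
    have := (Complex.abs_re_le_norm _).trans_lt (hd n k)
    rwa [Complex.sub_re] at this
  have hX1 : ∀ n, ‖f n (i n) / s n‖ ≤ 1 := fun n => by
    have h1 := norm_add_le (f n (i n) / s n - 1 / 2) (1 / 2)
    have h2 : ‖(1 / 2 : ℂ)‖ = 1 / 2 := by norm_num
    rw [sub_add_cancel, h2] at h1
    linarith [hX n]
  -- When `c` is flipped its proportion is near `1/2`, so it has to cross the whole interval.
  obtain ⟨n₁, -, hn₁⟩ := h.exists_flip c 0
  have h1 : 48 / 100 ≤ (f n₁ c / s n₁).re := by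
    have := abs_lt.mp (hreX n₁)
    rw [hn₁] at this
    linarith
  obtain ⟨p, q, -, hpq, -, hp, hq, hbt⟩ := exists_crossing (fun n => (f n c / s n).re)
    (show (-(48 / 100) : ℝ) < 48 / 100 by norm_num) (Nat.zero_le n₁) h0 h1
  have hne : ∀ n, p < n → n < q → i n ≠ c := by
    rintro n hpn hnq rfl
    have h3 := (hbt n hpn hnq).2
    have h4 := abs_lt.mp (hreX n)
    linarith
  have hpq1 : p + 1 < q := by
    rcases Nat.lt_or_ge (p + 1) q with h1 | h1
    · exact h1
    · have h2 : q = p + 1 := by omega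
      rw [h2] at hq
      have h4 := abs_lt.mp (hred p c)
      linarith
  have hre' : ∀ n, |(f (n + 1) (i n) / s (n + 1)).re - 1 / 2| < 1 / 10000 := by
    intro n
    rw [h.x_succ, Complex.sub_re, Complex.one_re,
      show (1 - (f n (i n) / s n).re - 1 / 2) = -((f n (i n) / s n).re - 1 / 2) by ring, abs_neg]
    exact hreX n
  have hip : i p ≠ c := by
    rintro rfl
    have h3 := (hbt (p + 1) (by omega) hpq1).2
    have h4 := abs_lt.mp (hre' p)
    linarith
  obtain ⟨e, he⟩ := exists_fourColors_of_ne_of_ne (h.ne p).symm hip (hne (p + 1) (by omega) hpq1)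
  -- During the crossing the two colours flipped last have proportions near `1/2`, so those of `c`
  -- and `e` nearly cancel. Neither has real part near `1/2`, so neither is flipped: the other two
  -- colours alternate.
  have hfour : ∀ n, p ≤ n → n + 1 < q → FourColors (i n) (i (n + 1)) c e := by
    intro n hn
    induction n, hn using Nat.le_induction with
    | base => exact fun _ => he
    | succ n hn ih =>
      intro hnq
      have h1 := ih (by omega)
      have h2 := congrArg Complex.re (h.sum_x (n + 1) h1)
      rw [Complex.add_re, Complex.add_re, Complex.add_re, Complex.one_re] at h2
      have h3 := abs_lt.mp (hre' n)
      have h4 := abs_lt.mp (hreX (n + 1))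
      have h5 := hbt (n + 1) (by omega) (by omega)
      have h6 := abs_lt.mp (hred (n + 1) e)
      have h7 : i (n + 2) ≠ e := by
        rintro rfl
        have h8 := abs_lt.mp (hreX (n + 2))
        simp only [add_assoc, Nat.reduceAdd] at *
        linarith
      have h8 := hne (n + 2) (by omega) (by omega)
      have h9 := h.ne (n + 1)
      obtain ⟨a1, a2, a3, a4, a5, a6⟩ := h1
      exact ⟨h9.symm, a4, a5, h8, h7, a6⟩
  have hcc : ∀ n, p < n → n ≤ q → f n c = f (p + 1) c ∧ f n e = f (p + 1) e := by
    intro n hn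
    change p + 1 ≤ n at hn
    induction n, hn using Nat.le_induction with
    | base => exact fun _ => ⟨rfl, rfl⟩
    | succ n hn ih =>
      intro hnq
      obtain ⟨m, rfl⟩ : ∃ m, n = m + 1 := ⟨n - 1, by omega⟩
      obtain ⟨-, -, -, a1, a2, -⟩ := hfour m (by omega) (by omega)
      rw [h.fix _ c a1.symm, h.fix _ e a2.symm]
      exact ih (by omega)
  set b := f (p + 1) c with hb
  set b' := f (p + 1) e with hb'
  -- A window of width `2/100`, less one step of at most `1/10000`, exceeds the `15/1000` that
  -- forces a rotation.
  have hrot : ∀ L : ℝ, -(48 / 100) ≤ L → L + 2 / 100 ≤ 48 / 100 → ∃ n, p < n ∧ n < q ∧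
      4 * (f n (i n) / s n - 1 / 2).re < ‖f n (i n) / s n - 1 / 2‖ ∧
      L ≤ (f n c / s n).re ∧ (f n c / s n).re ≤ L + 2 / 100 := by
    intro L hL1 hL2
    obtain ⟨p', q', h1, h2, h3, h4, h5, h6⟩ := exists_crossing (fun n => (f n c / s n).re)
      (show L < L + 2 / 100 by linarith) hpq.le (by linarith) (by linarith)
    obtain ⟨n, a1, a2, a3⟩ := h.exists_rotation hX1 hs h2 (c := c)
      (fun n hn hn' => by rw [(hcc n (by omega) (by omega)).1, (hcc _ (by omega) (by omega)).1])
      (by linarith [abs_lt.mp (hred p' c)])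
    exact ⟨n, by omega, by omega, a3, (h6 n a1 a2).1.le, (h6 n a1 a2).2.le⟩
  obtain ⟨n, n1, n2, n3, n4, n5⟩ := hrot (-(48 / 100)) le_rfl (by norm_num)
  obtain ⟨m, m1, m2, m3, m4, m5⟩ := hrot (46 / 100) (by norm_num) (by norm_num)
  have hb0 : b ≠ 0 := h.f_ne _ _
  have hb0' : b' ≠ 0 := h.f_ne _ _
  have hE : 0 < (1 - 4 / (b * b')).re := by
    have h1 : ‖4 / (b * b')‖ < 1 := by
      rw [norm_div, norm_mul, div_lt_one (by positivity)]
      have h1 := h.two_lt (p + 1) c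
      have h2 := h.two_lt (p + 1) e
      rw [← hb] at h1
      rw [← hb'] at h2
      norm_num
      nlinarith
    have h2 := Complex.re_le_norm (4 / (b * b'))
    rw [Complex.sub_re, Complex.one_re]
    linarith
  -- The values `b` and `b'` are fixed, so the alternating proportions have product `1 / (b * b')`
  -- and sum `1 - (b + b') / b * y`, where `y` is the proportion of `c`. Eliminating one of them
  -- gives a left side that does not depend on `n`.
  have hmain : ∀ n, p < n → n < q → 1 - 4 / (b * b') =
      4 * (f n (i n) / s n - 1 / 2) ^ 2 +
        4 * ((b + b') / b) * ((1 / 2 + (f n (i n) / s n - 1 / 2)) * (f n c / s n)) := by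
    intro n hn hn'
    obtain ⟨k, rfl⟩ : ∃ k, n = k + 1 := ⟨n - 1, by omega⟩
    have h1 := hfour k (by omega) (by omega)
    have h2 := h.sum_x (k + 1) h1
    have h3 := h.pair_eq (k + 1) h1
    obtain ⟨h4, h5⟩ := hcc (k + 1) hn hn'.le
    rw [h4, h5] at h2 h3
    rw [h4]
    have h6 : (b + b') / b * (b / s (k + 1)) = b / s (k + 1) + b' / s (k + 1) := by
      field_simp
    have h7 : 4 / (b * b') = 4 * (f (k + 1) (i k) / s (k + 1) *
        (f (k + 1) (i (k + 1)) / s (k + 1))) := by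
      rw [div_eq_iff (mul_ne_zero hb0 hb0')]
      linear_combination -4 * h3
    rw [h7]
    linear_combination -4 * (f (k + 1) (i (k + 1)) / s (k + 1)) * h6 -
      4 * (f (k + 1) (i (k + 1)) / s (k + 1)) * h2
  have hy : ∀ n, p < n → n < q → 498 / 1000 ≤ ‖f n c / s n‖ ∧ ‖f n c / s n‖ ≤ 503 / 1000 := by
    intro n hn hn'
    have h1 := h.two_lt n c
    have h2 := h.norm_f_lt n c
    have h3 := hs n
    have h4 := h.four_lt n
    rw [norm_div, le_div_iff₀ (by linarith), div_le_iff₀ (by linarith)]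
    constructor <;> nlinarith
  refine not_opposite_rotations hE (hmain n n1 n2) (hmain m m1 m2) ?_ n3 ?_ m3 ?_
  · have := h.half_le_re n
    rw [Complex.sub_re]; norm_num; linarith
  · have := h.half_le_re m
    rw [Complex.sub_re]; norm_num; linarith
  obtain ⟨y1, y2⟩ := hy n n1 n2
  obtain ⟨y3, y4⟩ := hy m m1 m2
  have hXn := hX n
  have hXm := hX m
  have hXn' := half_le_norm_of_re (h.half_le_re n)
  rw [add_sub_cancel, add_sub_cancel]
  set X := f n (i n) / s n
  set X' := f m (i m) / s m
  set y := f n c / s n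
  set y' := f m c / s m
  -- Both proportions of `c` have modulus near `1/2` and real part near `±1/2`, so their imaginary
  -- parts are small and they are nearly opposite.
  have him : ∀ z : ℂ, 46 / 100 ≤ |z.re| → ‖z‖ ≤ 503 / 1000 → |z.im| ≤ 205 / 1000 := by
    intro z h1 h2
    have h3 : ‖z‖ ^ 2 = z.re * z.re + z.im * z.im := by
      rw [← Complex.normSq_eq_norm_sq, Complex.normSq_apply]
    rw [← abs_mul_abs_self z.re, ← abs_mul_abs_self z.im] at h3
    by_contra hcon
    push Not at hcon
    nlinarith [norm_nonneg z]
  have i1 := him y (by rw [abs_of_neg (by linarith)]; linarith) y2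
  have i2 := him y' (by rw [abs_of_pos (by linarith)]; linarith) y4
  have s1 : ‖y + y'‖ ≤ 43 / 100 := by
    refine (Complex.norm_le_abs_re_add_abs_im _).trans ?_
    have r1 : |(y + y').re| ≤ 2 / 100 := by
      rw [Complex.add_re, abs_le]; constructor <;> linarith
    have r2 : |(y + y').im| ≤ 41 / 100 := by
      rw [Complex.add_im]
      exact (abs_add_le _ _).trans (by linarith)
    linarith
  have s2 : ‖X * y + X' * y'‖ ≤ 1 / 2 * ‖y + y'‖ + ‖X - 1 / 2‖ * ‖y‖ + ‖X' - 1 / 2‖ * ‖y'‖ := by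
    have : X * y + X' * y' = 1 / 2 * (y + y') + (X - 1 / 2) * y + (X' - 1 / 2) * y' := by ring
    rw [this]
    refine (norm_add₃_le).trans (le_of_eq ?_)
    rw [norm_mul, norm_mul, norm_mul]
    norm_num
  have s3 : ‖X * y‖ = ‖X‖ * ‖y‖ := norm_mul _ _
  rw [s3]
  have s4 : ‖X - 1 / 2‖ * ‖y‖ ≤ 1 / 10000 * (503 / 1000) := by gcongr
  have s5 : ‖X' - 1 / 2‖ * ‖y'‖ ≤ 1 / 10000 * (503 / 1000) := by gcongr
  have s6 : 1 / 2 * (498 / 1000) ≤ ‖X‖ * ‖y‖ := by gcongr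
  linarith

/-- There is no infinite descent all of whose values exceed `2`. -/
theorem false (h : Descent f s i) : False := by
  have h1 : ∀ᶠ n in atTop, ‖f n (i n) / s n - 1 / 2‖ < 1 / 10000 := by
    have := tendsto_iff_norm_sub_tendsto_zero.mp h.tendsto_half
    exact this.eventually_lt_const (by norm_num)
  have h2 : ∀ᶠ n in atTop, ∀ k, ‖f (n + 1) k / s (n + 1) - f n k / s n‖ < 1 / 10000 :=
    eventually_all.mpr fun k => (h.tendsto_diff k).eventually_lt_const (by norm_num)
  obtain ⟨N, hN⟩ := (h1.and h2).exists_forall_of_atTop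
  obtain ⟨n, hn, hne⟩ := h.exists_three N
  obtain ⟨c, hc⟩ := exists_fourColors_of_ne_of_ne (h.ne n).symm hne.symm (h.ne (n + 1)).symm
  have e1 := (hN (n + 2) (by omega)).1
  have e2 : ‖f (n + 2) (i (n + 1)) / s (n + 2) - 1 / 2‖ < 1 / 10000 := by
    rw [h.x_succ, ← norm_neg, show ∀ z : ℂ, -(1 - z - 1 / 2) = z - 1 / 2 by intro z; ring]
    exact (hN (n + 1) (by omega)).1
  have e3 : ‖f (n + 2) (i n) / s (n + 2) - 1 / 2‖ < 2 / 10000 := by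
    have a1 := (hN (n + 1) (by omega)).2 (i n)
    have a2 : ‖f (n + 1) (i n) / s (n + 1) - 1 / 2‖ < 1 / 10000 := by
      rw [h.x_succ, ← norm_neg, show ∀ z : ℂ, -(1 - z - 1 / 2) = z - 1 / 2 by intro z; ring]
      exact (hN n hn).1
    have a3 := norm_add_le (f (n + 1 + 1) (i n) / s (n + 1 + 1) - f (n + 1) (i n) / s (n + 1))
      (f (n + 1) (i n) / s (n + 1) - 1 / 2)
    rw [sub_add_sub_cancel] at a3
    simp only [add_assoc, Nat.reduceAdd] at *
    linarith
  have hsum := h.sum_x (n + 2) hc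
  have hpair := h.pair_eq (n + 2) hc
  have hsq := h.sq (n + 2) _ _ _ _ hc
  have hs0 := h.s_ne (n + 2)
  -- The other three proportions are near `1/2`, with errors `1`, `1` and `2` in units of `1/10000`.
  have e4 : ‖f (n + 2) c / s (n + 2) + 1 / 2‖ < 4 / 10000 := by
    have : f (n + 2) c / s (n + 2) + 1 / 2 =
        -(f (n + 2) (i n) / s (n + 2) - 1 / 2) + -(f (n + 2) (i (n + 1)) / s (n + 2) - 1 / 2) +
          -(f (n + 2) (i (n + 2)) / s (n + 2) - 1 / 2) := by linear_combination hsum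
    rw [this]
    refine (norm_add₃_le).trans_lt ?_
    rw [norm_neg, norm_neg, norm_neg]
    linarith
  -- The product of all four proportions is `1 / s ^ 2`, and its modulus is near `1/16`.
  have hs : ‖s (n + 2)‖ < 401 / 100 := by
    have hprod : s (n + 2) ^ 2 * (f (n + 2) (i n) / s (n + 2) *
        (f (n + 2) (i (n + 1)) / s (n + 2)) * (f (n + 2) (i (n + 2)) / s (n + 2)) *
        (f (n + 2) c / s (n + 2))) = 1 := by
      rw [← hpair]
      have := h.f_ne (n + 2) (i n)
      field_simp
    have hlow : ∀ z w : ℂ, ‖w‖ = 1 / 2 → ‖z - w‖ < 4 / 10000 → 4996 / 10000 ≤ ‖z‖ := by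
      intro z w hw hz
      have := norm_sub_norm_le w z
      rw [norm_sub_rev] at this
      linarith
    have b1 := hlow _ (1 / 2) (by norm_num) (e3.trans (by norm_num))
    have b2 := hlow _ (1 / 2) (by norm_num) (e2.trans (by norm_num))
    have b3 := hlow _ (1 / 2) (by norm_num) (e1.trans (by norm_num))
    have b4 := hlow _ (-(1 / 2)) (by norm_num) (by rw [sub_neg_eq_add]; exact e4)
    have := congrArg norm hprod
    rw [norm_mul, norm_pow, norm_mul, norm_mul, norm_mul, norm_one] at this
    have b5 : (4996 / 10000 : ℝ) * (4996 / 10000) * (4996 / 10000) * (4996 / 10000) ≤ _ :=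
      mul_le_mul (mul_le_mul (mul_le_mul b1 b2 (by norm_num) (norm_nonneg _)) b3 (by norm_num)
        (by positivity)) b4 (by norm_num) (by positivity)
    by_contra hcon
    push Not at hcon
    nlinarith
  refine (h.shift (n + 2)).no_half_turn (fun m => (hN _ (by omega)).1)
    (fun m k => ?_) (fun m => (h.antitone_norm_s (Nat.le_add_left _ _)).trans_lt hs) c ?_
  · have := (hN (m + (n + 2)) (by omega)).2 k
    rwa [add_right_comm] at this
  · have := abs_lt.mp ((Complex.abs_re_le_norm _).trans_lt e4)
    rw [Complex.add_re] at this
    norm_num at this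
    rw [zero_add]
    linarith

end Descent

end Rotation

/-! ### Sinks, and values of modulus at most `4`. -/

section Sinks

variable {φ : ThreeCell → ℂ}

theorem AdjAt.color_eq {c c' : Color} {v w : ZeroCell} (h : AdjAt c v w) (h' : AdjAt c' v w) :
    c = c' := by_contra fun hne => h.1 (h'.2 c hne)

theorem AdjAt.vsum_sub {c : Color} {v w : ZeroCell} (h : AdjAt c v w) (φ : ThreeCell → ℂ) :
    φ (cell w c) = φ (cell v c) + (vsum φ w - vsum φ v) := by
  obtain ⟨b, d, e, h'⟩ := exists_fourColors c
  obtain ⟨h1, h2, h3, -⟩ := id h'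
  rw [vsum, vsum, h'.sum_eq, h'.sum_eq, h.2 b h1.symm, h.2 d h2.symm, h.2 e h3.symm]
  ring

theorem IsMarkoffMap.vsum_ne (hφ : IsMarkoffMap φ) (h2 : ∀ x, 2 < ‖φ x‖) (v : ZeroCell) :
    vsum φ v ≠ 0 := by
  obtain ⟨b, c, d, h⟩ := exists_fourColors 0
  have h1 := norm_vsum_sq_gt (hφ.vsum_sq h v) (h2 _) (h2 _) (h2 _) (h2 _)
  intro h0
  rw [h0, norm_zero] at h1
  nlinarith [norm_nonneg (φ (cell v d))]

theorem IsMarkoffMap.half_le_re (hφ : IsMarkoffMap φ) (h2 : ∀ x, 2 < ‖φ x‖) {c : Color}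
    {v w : ZeroCell} (h : AdjAt c v w) (hle : ‖φ (cell w c)‖ ≤ ‖φ (cell v c)‖) :
    1 / 2 ≤ (φ (cell v c) / vsum φ v).re := by
  obtain ⟨b, d, e, h'⟩ := exists_fourColors c
  refine half_le_re_div (hφ.vsum_ne h2 v) (norm_pos_iff.mp (by linarith [h2 (cell v c)])) ?_
    (hφ.vsum_add h' h) (h.vsum_sub φ) hle
  rw [hφ.vsum_sq h']; ring

/-- The reverse flip starts from the proportion `1 - x`. -/
theorem IsMarkoffMap.re_le_half (hφ : IsMarkoffMap φ) (h2 : ∀ x, 2 < ‖φ x‖) {c : Color}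
    {v w : ZeroCell} (h : AdjAt c v w) (hle : ‖φ (cell v c)‖ ≤ ‖φ (cell w c)‖) :
    (φ (cell v c) / vsum φ v).re ≤ 1 / 2 := by
  have h1 := hφ.half_le_re h2 h.symm hle
  have h3 : φ (cell v c) / vsum φ v = 1 - φ (cell w c) / vsum φ w := by
    obtain ⟨b, d, e, h'⟩ := exists_fourColors c
    have e1 := hφ.vsum_sq h' v
    have e2 := hφ.vsum_add h' h
    have e3 := h.vsum_sub φ
    have := hφ.vsum_ne h2 v
    have := hφ.vsum_ne h2 w
    field_simp
    linear_combination φ (cell v c) * e2 - e1 + vsum φ v * e3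
  rw [h3, Complex.sub_re, Complex.one_re]
  linarith

/-- No two edges at a vertex can be directed away from it if all values exceed `2`. -/
theorem IsMarkoffMap.no_fork (hφ : IsMarkoffMap φ) (h2 : ∀ x, 2 < ‖φ x‖) {c c' : Color}
    {v w w' : ZeroCell} (h : AdjAt c v w) (h' : AdjAt c' v w')
    (hle : ‖φ (cell w c)‖ ≤ ‖φ (cell v c)‖) (hle' : ‖φ (cell w' c')‖ ≤ ‖φ (cell v c')‖) :
    c = c' := by
  by_contra hne
  obtain ⟨a, b, h4⟩ := exists_fourColors_of_ne hne
  have h5 := norm_div_mul_norm_div_lt (hφ.vsum_sq h4 v) (h2 _) (h2 _) (h2 _) (h2 _)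
  have h6 := half_le_norm_of_re (hφ.half_le_re h2 h hle)
  have h7 := half_le_norm_of_re (hφ.half_le_re h2 h' hle')
  nlinarith

/-- A relation directing edges so that values do not increase has a terminal vertex if all values
exceed `2`. -/
theorem IsMarkoffMap.exists_terminal (hφ : IsMarkoffMap φ) (h2 : ∀ x, 2 < ‖φ x‖)
    {R : ZeroCell → ZeroCell → Prop} (hadj : ∀ v w, R v w → oneSkeleton.Adj v w)
    (hasymm : ∀ v w, R v w → ¬ R w v)
    (hle : ∀ v w c, R v w → AdjAt c v w → ‖φ (cell w c)‖ ≤ ‖φ (cell v c)‖) :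
    ∃ v, ∀ w, ¬ R v w := by
  by_contra hcon
  push Not at hcon
  choose next hnext using hcon
  obtain ⟨v₀⟩ := oneSkeleton_connected.nonempty
  choose col hcol using fun v => adj_iff.mp (hadj _ _ (hnext v))
  set V : ℕ → ZeroCell := fun n => next^[n] v₀ with hV
  have hVs : ∀ n, V (n + 1) = next (V n) := fun n => Function.iterate_succ_apply' next n v₀
  have hA : ∀ n, AdjAt (col (V n)) (V n) (V (n + 1)) := fun n => by rw [hVs]; exact hcol _
  have hR : ∀ n, R (V n) (V (n + 1)) := fun n => by rw [hVs]; exact hnext _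
  have hD : Descent (fun n k => φ (cell (V n) k)) (fun n => vsum φ (V n)) fun n => col (V n) :=
    { two_lt := fun n k => h2 _
      sum := fun n a b c d h => h.sum_eq _
      sq := fun n a b c d h => hφ.vsum_sq h _
      fix := fun n k hk => by simp only [(hA n).2 k hk]
      flip := fun n b c d h => hφ.vsum_add h (hA n)
      le := fun n => hle _ _ _ (hR n) (hA n)
      -- Flipping the same colour again would lead back along the edge just used, against asymmetry.
      ne := fun n he => by
        have h1 := hA (n + 1)
        rw [he] at h1
        have h3 := (hA n).symm.unique h1
        exact hasymm _ _ (hR n) (h3 ▸ hR (n + 1)) }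
  exact hD.false

/-- Otherwise `‖x‖ * (1 - Re x) < 3/16`. But the left side is at least `‖x‖ * (1 - ‖x‖) ≥ 3/16` when
`1/4 ≤ ‖x‖ ≤ 1/2`, and at least `1/4` when `‖x‖ ≥ 1/2`. -/
theorem re_sum_lt_one {x y z w : ℂ} (hx : 1 / 4 ≤ ‖x‖) (hre : x.re ≤ 1 / 2)
    (hy : ‖x‖ * ‖y‖ < 1 / 16) (hz : ‖x‖ * ‖z‖ < 1 / 16) (hw : ‖x‖ * ‖w‖ < 1 / 16) :
    x.re + y.re + z.re + w.re < 1 := by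
  have h1 := Complex.re_le_norm x
  have h2 := Complex.re_le_norm y
  have h3 := Complex.re_le_norm z
  have h4 := Complex.re_le_norm w
  by_contra hcon
  push Not at hcon
  have h5 : ‖x‖ * (1 - x.re) < 3 / 16 := by nlinarith
  rcases le_total ‖x‖ (1 / 2) with h | h
  · nlinarith
  · nlinarith

/-- At a vertex none of whose flips decreases a value, some value is at most `4`. -/
theorem IsMarkoffMap.exists_le_four (hφ : IsMarkoffMap φ) (h2 : ∀ x, 2 < ‖φ x‖) {v : ZeroCell}
    (hv : ∀ c, (φ (cell v c) / vsum φ v).re ≤ 1 / 2) : ∃ x, ‖φ x‖ ≤ 4 := by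
  by_contra hcon
  push Not at hcon
  have hs := hφ.vsum_ne h2 v
  have hpair : ∀ a b, a ≠ b →
      ‖φ (cell v a) / vsum φ v‖ * ‖φ (cell v b) / vsum φ v‖ < 1 / 16 := by
    intro a b hab
    obtain ⟨c, d, h⟩ := exists_fourColors_of_ne hab
    have h1 := congrArg norm (hφ.vsum_sq h v)
    rw [norm_pow, norm_mul, norm_mul, norm_mul] at h1
    have h3 := hcon (cell v a)
    have h4 := hcon (cell v b)
    have h5 : 16 < ‖φ (cell v c)‖ * ‖φ (cell v d)‖ := by
      nlinarith [hcon (cell v c), hcon (cell v d)]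
    have h6 : 0 < ‖φ (cell v a)‖ * ‖φ (cell v b)‖ := by positivity
    rw [norm_div, norm_div, div_mul_div_comm, ← pow_two, h1, div_lt_div_iff₀ (by nlinarith)
      (by norm_num)]
    nlinarith
  obtain ⟨b, c, d, h⟩ := exists_fourColors 0
  have hsum : (φ (cell v 0) / vsum φ v).re + (φ (cell v b) / vsum φ v).re +
      (φ (cell v c) / vsum φ v).re + (φ (cell v d) / vsum φ v).re = 1 := by
    rw [← Complex.add_re, ← Complex.add_re, ← Complex.add_re, ← add_div, ← add_div, ← add_div]
    rw [show φ (cell v 0) + φ (cell v b) + φ (cell v c) + φ (cell v d) = vsum φ v from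
      (h.sum_eq fun k => φ (cell v k)).symm, div_self hs, Complex.one_re]
  obtain ⟨n1, n2, n3, n4, n5, n6⟩ := h
  rcases le_or_gt (1 / 4) ‖φ (cell v 0) / vsum φ v‖ with h0 | h0
  · have := re_sum_lt_one h0 (hv 0) (hpair 0 b n1) (hpair 0 c n2) (hpair 0 d n3)
    linarith
  rcases le_or_gt (1 / 4) ‖φ (cell v b) / vsum φ v‖ with hb | hb
  · have := re_sum_lt_one hb (hv b) (hpair b 0 n1.symm) (hpair b c n4) (hpair b d n5)
    linarith
  rcases le_or_gt (1 / 4) ‖φ (cell v c) / vsum φ v‖ with hc | hc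
  · have := re_sum_lt_one hc (hv c) (hpair c 0 n2.symm) (hpair c b n4.symm) (hpair c d n6)
    linarith
  rcases le_or_gt (1 / 4) ‖φ (cell v d) / vsum φ v‖ with hd | hd
  · have := re_sum_lt_one hd (hv d) (hpair d 0 n3.symm) (hpair d b n5.symm) (hpair d c n6.symm)
    linarith
  have := Complex.re_le_norm (φ (cell v 0) / vsum φ v)
  have := Complex.re_le_norm (φ (cell v b) / vsum φ v)
  have := Complex.re_le_norm (φ (cell v c) / vsum φ v)
  have := Complex.re_le_norm (φ (cell v d) / vsum φ v)
  linarith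

/-- Strict decrease is asymmetric by itself, so no choice at ties is needed; at a terminal vertex no
flip decreases a value. -/
theorem IsMarkoffMap.smallCells_four_nonempty (hφ : IsMarkoffMap φ) :
    (smallCells φ 4).Nonempty := by
  by_cases h2 : ∀ x, 2 < ‖φ x‖
  · obtain ⟨v, hv⟩ := hφ.exists_terminal h2
      (R := fun v w => ∃ c, AdjAt c v w ∧ ‖φ (cell w c)‖ < ‖φ (cell v c)‖)
      (fun v w ⟨c, h, _⟩ => adj_iff.mpr ⟨c, h⟩)
      (by
        rintro v w ⟨c, h, hlt⟩ ⟨c', h', hlt'⟩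
        obtain rfl := h.color_eq h'.symm
        exact lt_asymm hlt hlt')
      (by
        rintro v w c ⟨c', h', hlt⟩ h
        obtain rfl := h.color_eq h'
        exact hlt.le)
    refine hφ.exists_le_four h2 (v := v) fun c => ?_
    obtain ⟨w, hw⟩ := exists_adjAt v c
    exact hφ.re_le_half h2 hw (not_lt.mp fun hlt => hv w ⟨c, hw, hlt⟩)
  · push Not at h2
    obtain ⟨x, hx⟩ := h2
    exact ⟨x, show ‖φ x‖ ≤ 4 by linarith⟩

variable {O : ZeroCell → ZeroCell → Prop}

theorem IsInducedOrientation.asymm (hO : IsInducedOrientation φ O) {v w : ZeroCell} (h : O v w) :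
    ¬ O w v := by
  rcases hO.exactly_one v w (hO.adj v w h) with h' | h'
  · exact h'.2
  · exact absurd h h'.2

theorem IsInducedOrientation.or_of_adj (hO : IsInducedOrientation φ O) {v w : ZeroCell}
    (h : oneSkeleton.Adj v w) : O v w ∨ O w v := by
  rcases hO.exactly_one v w h with h' | h'
  · exact Or.inl h'.1
  · exact Or.inr h'.1

theorem IsInducedOrientation.le (hO : IsInducedOrientation φ O) {v w : ZeroCell} {c : Color}
    (h : O v w) (hc : AdjAt c v w) : ‖φ (cell w c)‖ ≤ ‖φ (cell v c)‖ :=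
  hO.norm_le v w h _ ⟨cell_mem v c, fun hm => hc.1 (cell_mem_iff.mp hm)⟩ _
    ⟨cell_mem w c, fun hm => hc.1 (cell_mem_iff.mp hm).symm⟩

theorem IsInducedOrientation.out_unique (hO : IsInducedOrientation φ O) (hφ : IsMarkoffMap φ)
    (h2 : ∀ x, 2 < ‖φ x‖) {v w w' : ZeroCell} (h : O v w) (h' : O v w') : w = w' := by
  obtain ⟨c, hc⟩ := adj_iff.mp (hO.adj _ _ h)
  obtain ⟨c', hc'⟩ := adj_iff.mp (hO.adj _ _ h')
  obtain rfl := hφ.no_fork h2 hc hc' (hO.le h hc) (hO.le h' hc')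
  exact hc.unique hc'

/-- The edge leaving `v` off the path is its only outgoing one, so the first edge of the path points
back to `v`; the same argument then applies to the next vertex. -/
theorem IsInducedOrientation.exists_out (hO : IsInducedOrientation φ O) (hφ : IsMarkoffMap φ)
    (h2 : ∀ x, 2 < ‖φ x‖) {v w : ZeroCell} (p : oneSkeleton.Walk v w) (hp : p.IsPath)
    {u : ZeroCell} (hu : u ∉ p.support) (hvu : O v u) : ∃ w', O w w' := by
  induction p generalizing u with
  | nil => exact ⟨u, hvu⟩
  | @cons v v₁ w hadj p ih =>
    rw [SimpleGraph.Walk.cons_isPath_iff] at hp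
    rcases hO.or_of_adj hadj with h | h
    · obtain rfl := hO.out_unique hφ h2 h hvu
      exact absurd (by simp) hu
    · exact ih hp.1 hp.2 h

theorem IsInducedOrientation.existsUnique_sink (hO : IsInducedOrientation φ O)
    (hφ : IsMarkoffMap φ) (h2 : ∀ x, 2 < ‖φ x‖) : ∃! v, IsSink O v := by
  obtain ⟨v, hv⟩ := hφ.exists_terminal h2 hO.adj (fun _ _ => hO.asymm) (fun _ _ _ => hO.le)
  have hsink : IsSink O v := fun w hw => (hO.or_of_adj hw).resolve_left (hv w)
  refine ⟨v, hsink, fun u hu => ?_⟩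
  by_contra hne
  obtain ⟨p, hp⟩ := (oneSkeleton_connected.preconnected u v).exists_isPath
  cases p with
  | nil => exact hne rfl
  | cons hadj p =>
    rw [SimpleGraph.Walk.cons_isPath_iff] at hp
    obtain ⟨w', hw'⟩ := hO.exists_out hφ h2 p hp.1 hp.2 (hu _ hadj)
    exact hv w' hw'

end Sinks

end CurveComplex

theorem mainTheorem9 (φ : CurveComplex.ThreeCell → ℂ) (hφ : CurveComplex.IsMarkoffMap φ) :
    (CurveComplex.smallCells φ 4).Nonempty ∧
    (CurveComplex.smallCells φ 2 = ∅ →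
      ∀ O : CurveComplex.ZeroCell → CurveComplex.ZeroCell → Prop,
        CurveComplex.IsInducedOrientation φ O → ∃! v, CurveComplex.IsSink O v) := by
  refine ⟨hφ.smallCells_four_nonempty, fun h O hO => hO.existsUnique_sink hφ fun x => ?_⟩
  by_contra hx
  exact Set.notMem_empty x (h ▸ not_lt.mp hx)
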